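/- Let $M$ be a complex manifold of dimension $n$, let $x \in M$, and let $z=(z_1,\dots,z_n)$ be local holomorphic coordinates on a neighbourhood $U$ of $x$ with $z(x)=0$. Let $\pi\colon \tilde M\to M$ be the blowup of $M$ at $x$ (constructed with these coordinates): the complex manifold obtained by gluing $M\setminus\{x\}$ and $$\tilde U=\{(p,[l])\in U\times\mathbb P^{n-1} : z_i(p)\,l_j=z_j(p)\,l_i \text{ for all } i,j\}$$ along $U\setminus\{x\}$, where $\tilde U$ has the coordinates $z^i_i=z_i$, $z^i_j=l_j/l_i$ $(j\neq i)$ on $\tilde U_i=\{l_i\ne 0\}$. Let $E=\pi^{-1}(x)$ be the exceptional divisor, with local defining functions $z_i$ on $\tilde U_i$ and $1$ on $\tilde M\setminus E$. For an integer $k$ let $[kE]$ be the holomorphic line bundle with transition functions $f_\alpha^k/f_\beta^k$, where the $f_\alpha$ are these local defining functions of $E$. For a complex manifold $X$ of dimension $n$ let $K_X=\Lambda^n T^*X$ be its canonical bundle, the line bundle of holomorphic $n$-forms. Then there is an isomorphism of holomorphic line bundles on $\tilde M$ $$K_{\tilde M}\;\cong\;\pi^*K_M\otimes[(n-1)E].$$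 -/

import Mathlib

open scoped Manifold ContDiff LinearAlgebra.Projectivization

noncomputable section

namespace KodairaBlowup

universe u v w v' w'

/-- The model space `ℂⁿ`. -/
abbrev Cn (n : ℕ) : Type := Fin n → ℂ

variable {n : ℕ} {M : Type u} [TopologicalSpace M] [ChartedSpace (Cn n) M]

/-! ### The blowup of a complex manifold at a point -/

/-- Local holomorphic coordinates `(z₁, …, zₙ)` about the point `x`, vanishing at `x`. -/
structure LocalCoord (n : ℕ) {M : Type u} [TopologicalSpace M] [ChartedSpace (Cn n) M] (x : M) where
  /-- the coordinate chart -/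
  chart : OpenPartialHomeomorph M (Cn n)
  mem_maximalAtlas : chart ∈ IsManifold.maximalAtlas 𝓘(ℂ, Cn n) ω M
  mem_source : x ∈ chart.source
  map_zero : chart x = 0

/-- The set underlying the blowup: outside the centre it is `M ∖ {x}`, and the centre is replaced
by the projective space `ℙⁿ⁻¹` of lines through the origin. In the coordinates `z` on `U` the part
over `U` is `{(z, l) ∈ U × ℙⁿ⁻¹ | zᵢ lⱼ = zⱼ lᵢ}`, see `Blowup.incidence_eq` and
`Blowup.incidence_existsUnique`. -/
inductive Blowup {x : M} (c : LocalCoord n x) : Type u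
  /-- a point of `M` other than the centre -/
  | away (p : M) (hp : p ≠ x) : Blowup c
  /-- a point `(0, l)` over the centre -/
  | exc (l : ℙ ℂ (Cn n)) : Blowup c

/-- Every point has such coordinates. -/
theorem LocalCoord.nonempty [IsManifold 𝓘(ℂ, Cn n) ω M] (x : M) : Nonempty (LocalCoord n x) := by
  let a := chartAt (Cn n) x x
  let τ : Cn n ≃ₜ Cn n := Homeomorph.subRight a
  let e : OpenPartialHomeomorph M (Cn n) := (chartAt (Cn n) x).trans τ.toOpenPartialHomeomorph
  have hm := IsManifold.chart_mem_maximalAtlas (I := 𝓘(ℂ, Cn n)) (n := ω) x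
  have h1 : ContDiff ℂ ω fun w : Cn n => w - a := by fun_prop
  have h2 : ContDiff ℂ ω fun w : Cn n => w + a := by fun_prop
  refine ⟨⟨e, OpenPartialHomeomorph.mem_maximalAtlas_of_contMDiffOn e ?_ ?_, ?_, ?_⟩⟩
  · exact (h1.contMDiff.comp_contMDiffOn (contMDiffOn_of_mem_maximalAtlas hm)).mono
      fun y hy => hy.1
  · exact (contMDiffOn_symm_of_mem_maximalAtlas hm).comp h2.contMDiff.contMDiffOn
      fun w hw => hw.2
  · simp [e]
  · simp [e, τ, a]

namespace Blowup

variable {x : M} (c : LocalCoord n x)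

/-- The projection `π` of the blowup onto `M`. -/
def proj : Blowup c → M
  | away p _ => p
  | exc _ => x

/-- Homogeneous coordinates of the line `l` of a point `(z, l)` over the coordinate neighbourhood:
`l = [z]` if `z ≠ 0`. -/
def dir : Blowup c → Cn n
  | away p _ => c.chart p
  | exc l => l.rep

/-- The map `(w₁, …, wₙ) ↦ (wᵢ w₁, …, wᵢ, …, wᵢ wₙ)`, which is `π` in the `i`-th affine chart. -/
def down (i : Fin n) (w : Cn n) : Cn n := fun j => if j = i then w i else w i * w j

/-- The `i`-th affine coordinates `zⱼⁱ = lⱼ / lᵢ` for `j ≠ i` and `zᵢⁱ = zᵢ`. -/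
def affineFun (i : Fin n) (q : Blowup c) : Cn n :=
  fun j => if j = i then c.chart (proj c q) i else dir c q j / dir c q i

theorem update_ne_zero (i : Fin n) (w : Cn n) : Function.update w i 1 ≠ 0 := by
  intro h
  have := congrFun h i
  simp at this

open Classical in
/-- The inverse of the affine coordinates. -/
def affineInv (i : Fin n) (w : Cn n) : Blowup c :=
  if h : c.chart.symm (down i w) ≠ x then away (c.chart.symm (down i w)) h
  else exc (Projectivization.mk ℂ (Function.update w i 1) (update_ne_zero i w))

variable {c}

theorem chart_eq_zero_iff {p : M} (hp : p ∈ c.chart.source) : c.chart p = 0 ↔ p = x := by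
  rw [← c.map_zero]
  exact ⟨fun h => c.chart.injOn hp c.mem_source h, fun h => by rw [h]⟩

theorem symm_eq_iff {v : Cn n} (hv : v ∈ c.chart.target) : c.chart.symm v = x ↔ v = 0 := by
  rw [← chart_eq_zero_iff (c.chart.map_target hv), c.chart.right_inv hv]

theorem down_eq_zero_iff {i : Fin n} {w : Cn n} : down i w = 0 ↔ w i = 0 := by
  constructor
  · intro h
    simpa [down] using congrFun h i
  · intro h
    funext j
    simp [down, h]

theorem affineInv_of_ne {i : Fin n} {w : Cn n} (hw : down i w ∈ c.chart.target) (h : w i ≠ 0) :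
    affineInv c i w = away (c.chart.symm (down i w))
      fun h' => h (down_eq_zero_iff.1 ((symm_eq_iff hw).1 h')) := by
  unfold affineInv
  rw [dif_pos]

theorem affineInv_of_eq {i : Fin n} {w : Cn n} (hw : down i w ∈ c.chart.target) (h : w i = 0) :
    affineInv c i w = exc (Projectivization.mk ℂ (Function.update w i 1)
      (update_ne_zero i w)) := by
  unfold affineInv
  rw [dif_neg]
  rw [not_not]
  exact (symm_eq_iff hw).2 (down_eq_zero_iff.2 h)

theorem proj_affineInv {i : Fin n} {w : Cn n} (hw : down i w ∈ c.chart.target) :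
    proj c (affineInv c i w) = c.chart.symm (down i w) := by
  by_cases h : w i = 0
  · rw [affineInv_of_eq hw h]
    exact ((symm_eq_iff hw).2 (down_eq_zero_iff.2 h)).symm
  · rw [affineInv_of_ne hw h]
    rfl

theorem dir_affineInv {i : Fin n} {w : Cn n} (hw : down i w ∈ c.chart.target) :
    ∃ a : ℂ, a ≠ 0 ∧ dir c (affineInv c i w) = a • Function.update w i 1 := by
  by_cases h : w i = 0
  · rw [affineInv_of_eq hw h]
    obtain ⟨a, ha⟩ := Projectivization.exists_smul_eq_mk_rep ℂ _ (update_ne_zero i w)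
    exact ⟨a, a.ne_zero, ha.symm⟩
  · rw [affineInv_of_ne hw h]
    refine ⟨w i, h, ?_⟩
    change c.chart (c.chart.symm (down i w)) = _
    rw [c.chart.right_inv hw]
    funext j
    by_cases hj : j = i
    · subst hj; simp [down]
    · simp [down, hj]

theorem down_affineFun {i : Fin n} {q : Blowup c} (_hq : proj c q ∈ c.chart.source)
    (hi : dir c q i ≠ 0) : down i (affineFun c i q) = c.chart (proj c q) := by
  funext j
  by_cases hj : j = i
  · subst hj; simp [down, affineFun]
  · rcases q with ⟨p, hp⟩ | l
    · change c.chart p i ≠ 0 at hi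
      simp only [down, affineFun, hj, if_false, if_true, proj, dir]
      field_simp
    · simp [down, affineFun, hj, proj, c.map_zero]

variable (c)

/-- The `i`-th affine chart, defined on `{(z, l) | z ∈ U, lᵢ ≠ 0}`. -/
def affineChart (i : Fin n) : PartialEquiv (Blowup c) (Cn n) where
  toFun := affineFun c i
  invFun := affineInv c i
  source := {q | proj c q ∈ c.chart.source ∧ dir c q i ≠ 0}
  target := {w | down i w ∈ c.chart.target}
  map_source' := by
    rintro q ⟨hq, hi⟩
    change down i (affineFun c i q) ∈ c.chart.target
    rw [down_affineFun hq hi]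
    exact c.chart.map_source hq
  map_target' := by
    intro w hw
    replace hw : down i w ∈ c.chart.target := hw
    obtain ⟨a, ha, h⟩ := dir_affineInv (c := c) hw
    refine ⟨?_, ?_⟩
    · rw [proj_affineInv hw]
      exact c.chart.map_target hw
    · rw [h]
      simpa using ha
  left_inv' := by
    rintro q ⟨hq, hi⟩
    have ht : down i (affineFun c i q) ∈ c.chart.target := by
      rw [down_affineFun hq hi]
      exact c.chart.map_source hq
    rcases q with ⟨p, hp⟩ | l
    · change c.chart p i ≠ 0 at hi
      have h0 : affineFun c i (away p hp) i ≠ 0 := by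
        simpa [affineFun, proj] using hi
      rw [affineInv_of_ne ht h0]
      have h : c.chart.symm (down i (affineFun c i (away p hp))) = p := by
        rw [down_affineFun hq hi]
        exact c.chart.left_inv hq
      simp only [h]
    · change l.rep i ≠ 0 at hi
      have h0 : affineFun c i (exc l) i = 0 := by
        simp [affineFun, proj, c.map_zero]
      rw [affineInv_of_eq ht h0]
      refine congrArg exc ?_
      conv_rhs => rw [← l.mk_rep]
      rw [Projectivization.mk_eq_mk_iff']
      refine ⟨(l.rep i)⁻¹, ?_⟩
      funext j
      by_cases hj : j = i
      · subst hj; simp [hi]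
      · simp [hj, affineFun, dir, div_eq_inv_mul]
  right_inv' := by
    intro w hw
    replace hw : down i w ∈ c.chart.target := hw
    obtain ⟨a, ha, h⟩ := dir_affineInv (c := c) hw
    funext j
    by_cases hj : j = i
    · subst hj
      simp only [affineFun, if_true]
      rw [proj_affineInv hw, c.chart.right_inv hw]
      simp [down]
    · simp only [affineFun, hj, if_false, h]
      simp [hj, ha]

open Classical in
/-- The inverse of a chart away from the centre. -/
def awayInv (p : {p : M // p ≠ x}) (w : Cn n) : Blowup c :=
  if h : (chartAt (Cn n) p.1).symm w ≠ x then away ((chartAt (Cn n) p.1).symm w) h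
  else away p.1 p.2

variable {c} in
theorem awayInv_of_ne {p : {p : M // p ≠ x}} {w : Cn n}
    (h : (chartAt (Cn n) p.1).symm w ≠ x) :
    awayInv c p w = away ((chartAt (Cn n) p.1).symm w) h := by
  unfold awayInv
  rw [dif_pos h]

variable {c} in
theorem proj_awayInv {p : {p : M // p ≠ x}} {w : Cn n}
    (h : (chartAt (Cn n) p.1).symm w ≠ x) :
    proj c (awayInv c p w) = (chartAt (Cn n) p.1).symm w := by
  rw [awayInv_of_ne h]
  rfl

/-- The chart of `M` at a point `p ≠ x`, restricted to `M ∖ {x}` and lifted to the blowup. -/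
def awayChart (p : {p : M // p ≠ x}) : PartialEquiv (Blowup c) (Cn n) where
  toFun q := chartAt (Cn n) p.1 (proj c q)
  invFun := awayInv c p
  source := {q | proj c q ≠ x ∧ proj c q ∈ (chartAt (Cn n) p.1).source}
  target := {w | w ∈ (chartAt (Cn n) p.1).target ∧ (chartAt (Cn n) p.1).symm w ≠ x}
  map_source' := by
    rintro q ⟨hx, hq⟩
    refine ⟨(chartAt (Cn n) p.1).map_source hq, ?_⟩
    rwa [(chartAt (Cn n) p.1).left_inv hq]
  map_target' := by
    rintro w ⟨hw, hx⟩
    rw [Set.mem_ofPred_eq, proj_awayInv hx]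
    exact ⟨hx, (chartAt (Cn n) p.1).map_target hw⟩
  left_inv' := by
    rintro q ⟨hx, hq⟩
    have h : (chartAt (Cn n) p.1).symm (chartAt (Cn n) p.1 (proj c q)) = proj c q :=
      (chartAt (Cn n) p.1).left_inv hq
    rw [awayInv_of_ne (by rwa [h])]
    rcases q with ⟨q, hq'⟩ | l
    · change (chartAt (Cn n) p.1).symm (chartAt (Cn n) p.1 q) = q at h
      simp only [proj, h]
    · exact absurd rfl hx
  right_inv' := by
    rintro w ⟨hw, hx⟩
    rw [proj_awayInv hx]
    exact (chartAt (Cn n) p.1).right_inv hw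

variable {c} in
/-- A point of the blowup over the coordinate neighbourhood determines a line `l` and satisfies the
equations `zᵢ lⱼ = zⱼ lᵢ`. -/
theorem incidence_eq (q : Blowup c) (hq : proj c q ∈ c.chart.source) :
    dir c q ≠ 0 ∧ ∀ i j, c.chart (proj c q) i * dir c q j = c.chart (proj c q) j * dir c q i := by
  rcases q with ⟨p, hp⟩ | l
  · refine ⟨fun h => hp ((chart_eq_zero_iff hq).1 h), fun i j => mul_comm _ _⟩
  · refine ⟨l.rep_nonzero, fun i j => ?_⟩
    simp [proj, c.map_zero]

variable {c} in
/-- Over the coordinate neighbourhood the blowup is the incidence variety of all pairs `(z, l)`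
with `zᵢ lⱼ = zⱼ lᵢ`. -/
theorem incidence_existsUnique (z : Cn n) (hz : z ∈ c.chart.target) (l : ℙ ℂ (Cn n))
    (h : ∀ i j, z i * l.rep j = z j * l.rep i) :
    ∃! q : Blowup c, proj c q ∈ c.chart.source ∧ c.chart (proj c q) = z ∧
      ∃ a : ℂ, a ≠ 0 ∧ dir c q = a • l.rep := by
  by_cases h0 : z = 0
  · subst h0
    refine ⟨exc l, ⟨c.mem_source, c.map_zero, 1, one_ne_zero, (one_smul _ _).symm⟩, ?_⟩
    rintro (⟨p, hp⟩ | l') ⟨hq, hz', a, ha, hd⟩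
    · exact absurd ((chart_eq_zero_iff hq).1 hz') hp
    · refine congrArg exc ?_
      rw [← l'.mk_rep, ← l.mk_rep, Projectivization.mk_eq_mk_iff']
      exact ⟨a, hd.symm⟩
  · have hx : c.chart.symm z ≠ x := fun h' => h0 ((symm_eq_iff hz).1 h')
    obtain ⟨i, hi⟩ := Function.ne_iff.1 l.rep_nonzero
    have hzi : z = (z i / l.rep i) • l.rep := by
      funext j
      rw [Pi.smul_apply, smul_eq_mul, div_mul_eq_mul_div, eq_div_iff hi, h i j]
    refine ⟨away (c.chart.symm z) hx, ⟨c.chart.map_target hz, c.chart.right_inv hz,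
      z i / l.rep i, ?_, ?_⟩, ?_⟩
    · intro h'
      rw [h', zero_smul] at hzi
      exact h0 hzi
    · exact (c.chart.right_inv hz).trans hzi
    · rintro (⟨p, hp⟩ | l') ⟨hq, hz', a, ha, hd⟩
      · have : c.chart.symm z = p := by
          rw [← hz']; exact c.chart.left_inv hq
        simp only [this]
      · exact absurd (hz'.symm.trans c.map_zero) h0

theorem contDiff_down (i : Fin n) : ContDiff ℂ ω (down i) := by
  unfold down
  refine contDiff_pi.2 fun j => ?_
  by_cases hj : j = i
  · simp only [hj, if_true]; fun_prop
  · simp only [hj, if_false]; fun_prop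

/-- Coordinate changes between charts of the maximal atlas are holomorphic. -/
theorem contDiffOn_coordChange {e e' : OpenPartialHomeomorph M (Cn n)}
    (he : e ∈ IsManifold.maximalAtlas 𝓘(ℂ, Cn n) ω M)
    (he' : e' ∈ IsManifold.maximalAtlas 𝓘(ℂ, Cn n) ω M) :
    ContDiffOn ℂ ω (fun w => e' (e.symm w)) (e.target ∩ e.symm ⁻¹' e'.source) := by
  have h1 := contMDiffOn_symm_of_mem_maximalAtlas (n := ω) he
  have h2 := contMDiffOn_of_mem_maximalAtlas (n := ω) he'
  exact (h2.comp' h1).contDiffOn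

/-- The coordinate change from `e` to `e'` has open domain and is holomorphic. -/
def Compatible (e e' : PartialEquiv (Blowup c) (Cn n)) : Prop :=
  IsOpen (e.symm.trans e').source ∧ ContDiffOn ℂ ω (e.symm.trans e') (e.symm.trans e').source

variable {c} in
theorem Compatible.of_eq {e e' : PartialEquiv (Blowup c) (Cn n)} {s : Set (Cn n)}
    {f : Cn n → Cn n} (hs : (e.symm.trans e').source = s) (ho : IsOpen s)
    (hf : ContDiffOn ℂ ω f s) (h : ∀ w ∈ s, e' (e.symm w) = f w) : Compatible c e e' := by
  refine ⟨hs ▸ ho, ?_⟩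
  rw [hs]
  exact hf.congr h

section
variable [IsManifold 𝓘(ℂ, Cn n) ω M]

theorem compatible_away_away (p p' : {p : M // p ≠ x}) :
    Compatible c (awayChart c p) (awayChart c p') := by
  have : T1Space M := ChartedSpace.t1Space (Cn n) M
  set e := chartAt (Cn n) p.1 with he
  set e' := chartAt (Cn n) p'.1 with he'
  refine Compatible.of_eq (s := e.target ∩ e.symm ⁻¹' (e'.source ∩ {x}ᶜ))
    (f := fun w => e' (e.symm w)) ?_ ?_ ?_ ?_
  · ext w
    constructor
    · rintro ⟨⟨hw, hx⟩, -, h⟩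
      refine ⟨hw, ?_, hx⟩
      change proj c (awayInv c p w) ∈ _ at h
      rwa [proj_awayInv hx] at h
    · rintro ⟨hw, h, hx⟩
      refine ⟨⟨hw, hx⟩, ?_⟩
      change proj c (awayInv c p w) ≠ x ∧ proj c (awayInv c p w) ∈ _
      rw [proj_awayInv hx]
      exact ⟨hx, h⟩
  · exact e.isOpen_inter_preimage_symm (e'.open_source.inter isOpen_compl_singleton)
  · exact (contDiffOn_coordChange (IsManifold.chart_mem_maximalAtlas _)
      (IsManifold.chart_mem_maximalAtlas _)).mono fun w hw => ⟨hw.1, hw.2.1⟩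
  · rintro w ⟨hw, h, hx⟩
    change e' (proj c (awayInv c p w)) = _
    rw [proj_awayInv hx]

theorem compatible_affine_away (i : Fin n) (p' : {p : M // p ≠ x}) :
    Compatible c (affineChart c i) (awayChart c p') := by
  have : T1Space M := ChartedSpace.t1Space (Cn n) M
  set e' := chartAt (Cn n) p'.1 with he'
  refine Compatible.of_eq
    (s := down i ⁻¹' (c.chart.target ∩ c.chart.symm ⁻¹' (e'.source ∩ {x}ᶜ)))
    (f := fun w => e' (c.chart.symm (down i w))) ?_ ?_ ?_ ?_
  · ext w
    constructor
    · rintro ⟨hw, hx, h⟩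
      replace hw : down i w ∈ c.chart.target := hw
      refine ⟨hw, ?_⟩
      change proj c (affineInv c i w) ∈ _ at h
      change proj c (affineInv c i w) ≠ x at hx
      rw [proj_affineInv hw] at h hx
      exact ⟨h, hx⟩
    · rintro ⟨hw, h, hx⟩
      refine ⟨hw, ?_⟩
      change proj c (affineInv c i w) ≠ x ∧ proj c (affineInv c i w) ∈ _
      rw [proj_affineInv hw]
      exact ⟨hx, h⟩
  · exact (c.chart.isOpen_inter_preimage_symm
      (e'.open_source.inter isOpen_compl_singleton)).preimage (contDiff_down i).continuous
  · exact (contDiffOn_coordChange c.mem_maximalAtlas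
      (IsManifold.chart_mem_maximalAtlas _)).comp (contDiff_down i).contDiffOn
        fun w hw => ⟨hw.1, hw.2.1⟩
  · rintro w ⟨hw, h, hx⟩
    change e' (proj c (affineInv c i w)) = _
    rw [proj_affineInv hw]

theorem compatible_away_affine (p : {p : M // p ≠ x}) (i : Fin n) :
    Compatible c (awayChart c p) (affineChart c i) := by
  have : T1Space M := ChartedSpace.t1Space (Cn n) M
  set e := chartAt (Cn n) p.1 with he
  have hs : IsOpen (c.chart.source ∩ c.chart ⁻¹' {v | v i ≠ 0}) :=
    c.chart.isOpen_inter_preimage (isOpen_ne.preimage (continuous_apply i))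
  have hcc := contDiffOn_coordChange (IsManifold.chart_mem_maximalAtlas p.1) c.mem_maximalAtlas
  refine Compatible.of_eq
    (s := e.target ∩ e.symm ⁻¹' (c.chart.source ∩ c.chart ⁻¹' {v | v i ≠ 0} ∩ {x}ᶜ))
    (f := fun w j => if j = i then c.chart (e.symm w) i
      else c.chart (e.symm w) j / c.chart (e.symm w) i) ?_ ?_ ?_ ?_
  · ext w
    constructor
    · rintro ⟨⟨hw, hx⟩, h, hi⟩
      change proj c (awayInv c p w) ∈ _ at h
      change dir c (awayInv c p w) i ≠ 0 at hi
      rw [proj_awayInv hx] at h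
      rw [awayInv_of_ne hx] at hi
      exact ⟨hw, ⟨h, hi⟩, hx⟩
    · rintro ⟨hw, ⟨h, hi⟩, hx⟩
      refine ⟨⟨hw, hx⟩, ?_⟩
      change proj c (awayInv c p w) ∈ _ ∧ dir c (awayInv c p w) i ≠ 0
      rw [proj_awayInv hx, awayInv_of_ne hx]
      exact ⟨h, hi⟩
  · exact e.isOpen_inter_preimage_symm (hs.inter isOpen_compl_singleton)
  · have h1 : ∀ j, ContDiffOn ℂ ω (fun w => c.chart (e.symm w) j)
        (e.target ∩ e.symm ⁻¹' (c.chart.source ∩ c.chart ⁻¹' {v | v i ≠ 0} ∩ {x}ᶜ)) :=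
      fun j => (contDiffOn_pi.1 hcc j).mono fun w hw => ⟨hw.1, hw.2.1.1⟩
    refine contDiffOn_pi.2 fun j => ?_
    by_cases hj : j = i
    · simp only [hj, if_true]
      exact h1 i
    · simp only [hj, if_false]
      exact (h1 j).div (h1 i) fun w hw => hw.2.1.2
  · rintro w ⟨hw, h, hx⟩
    change affineFun c i (awayInv c p w) = _
    rw [awayInv_of_ne hx]
    rfl

end

theorem compatible_affine_affine (i j : Fin n) :
    Compatible c (affineChart c i) (affineChart c j) := by
  have hu : ContDiff ℂ ω (fun w : Cn n => Function.update w i 1) := by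
    refine contDiff_pi.2 fun m => ?_
    by_cases hm : m = i
    · subst hm; simp only [Function.update_self]; fun_prop
    · simp only [Function.update_of_ne hm]; fun_prop
  have hu' : ∀ m, ContDiff ℂ ω (fun w : Cn n => Function.update w i 1 m) :=
    fun m => contDiff_pi.1 hu m
  refine Compatible.of_eq
    (s := down i ⁻¹' c.chart.target ∩ {w | Function.update w i 1 j ≠ 0})
    (f := fun w m => if m = j then down i w j
      else Function.update w i 1 m / Function.update w i 1 j) ?_ ?_ ?_ ?_
  · ext w
    constructor
    · rintro ⟨hw, h, hj⟩
      replace hw : down i w ∈ c.chart.target := hw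
      refine ⟨hw, ?_⟩
      change dir c (affineInv c i w) j ≠ 0 at hj
      obtain ⟨a, ha, hd⟩ := dir_affineInv hw
      rw [hd] at hj
      exact fun h' => hj (by simp [h'])
    · rintro ⟨hw, hj⟩
      replace hw : down i w ∈ c.chart.target := hw
      refine ⟨hw, ?_⟩
      change proj c (affineInv c i w) ∈ _ ∧ dir c (affineInv c i w) j ≠ 0
      obtain ⟨a, ha, hd⟩ := dir_affineInv hw
      rw [hd, proj_affineInv hw]
      exact ⟨c.chart.map_target hw, mul_ne_zero ha hj⟩
  · exact (c.chart.open_target.preimage (contDiff_down i).continuous).inter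
      (isOpen_ne.preimage (hu' j).continuous)
  · refine contDiffOn_pi.2 fun m => ?_
    by_cases hm : m = j
    · simp only [hm, if_true]
      exact (contDiff_pi.1 (contDiff_down i) j).contDiffOn
    · simp only [hm, if_false]
      exact (hu' m).contDiffOn.div (hu' j).contDiffOn fun w hw => hw.2
  · rintro w ⟨hw, hj⟩
    replace hw : down i w ∈ c.chart.target := hw
    change affineFun c j (affineInv c i w) = _
    obtain ⟨a, ha, hd⟩ := dir_affineInv hw
    funext m
    by_cases hm : m = j
    · simp only [affineFun, hm, if_true]
      rw [proj_affineInv hw, c.chart.right_inv hw]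
    · simp only [affineFun, hm, if_false, hd, Pi.smul_apply, smul_eq_mul]
      rw [mul_div_mul_left _ _ ha]

/-- The atlas of the blowup. -/
def charts : Set (PartialEquiv (Blowup c) (Cn n)) :=
  Set.range (awayChart c) ∪ Set.range (affineChart c)

theorem exists_chart (q : Blowup c) : ∃ e ∈ charts c, q ∈ e.source := by
  rcases q with ⟨p, hp⟩ | l
  · exact ⟨awayChart c ⟨p, hp⟩, Or.inl ⟨_, rfl⟩, hp, mem_chart_source (Cn n) p⟩
  · obtain ⟨i, hi⟩ := Function.ne_iff.1 l.rep_nonzero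
    exact ⟨affineChart c i, Or.inr ⟨_, rfl⟩, c.mem_source, hi⟩

section
variable [IsManifold 𝓘(ℂ, Cn n) ω M]

theorem compatible_of_mem_charts {e e' : PartialEquiv (Blowup c) (Cn n)} (he : e ∈ charts c)
    (he' : e' ∈ charts c) : Compatible c e e' := by
  rcases he with ⟨p, rfl⟩ | ⟨i, rfl⟩ <;> rcases he' with ⟨p', rfl⟩ | ⟨j, rfl⟩
  · exact compatible_away_away c p p'
  · exact compatible_away_affine c p j
  · exact compatible_affine_away c i p'
  · exact compatible_affine_affine c i j

/-- The charted space structure of the blowup; it also defines its topology. -/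
def core : ChartedSpaceCore (Cn n) (Blowup c) where
  atlas := charts c
  chartAt q := (exists_chart c q).choose
  mem_chart_source q := (exists_chart c q).choose_spec.2
  chart_mem_atlas q := (exists_chart c q).choose_spec.1
  open_source _ _ he he' := (compatible_of_mem_charts c he he').1
  continuousOn_toFun _ _ he he' := (compatible_of_mem_charts c he he').2.continuousOn

instance : TopologicalSpace (Blowup c) := (core c).toTopologicalSpace

instance : ChartedSpace (Cn n) (Blowup c) := (core c).toChartedSpace

theorem exists_of_mem_atlas {e : OpenPartialHomeomorph (Blowup c) (Cn n)}
    (he : e ∈ atlas (Cn n) (Blowup c)) :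
    ∃ e' , ∃ h : e' ∈ charts c, e = (core c).openPartialHomeomorph e' h := by
  change e ∈ ⋃ (e : PartialEquiv (Blowup c) (Cn n)) (he : e ∈ (core c).atlas),
    {(core c).openPartialHomeomorph e he} at he
  obtain ⟨e', h, he⟩ := Set.mem_iUnion₂.1 he
  exact ⟨e', h, he⟩

/-- The blowup is a complex manifold. -/
instance : IsManifold 𝓘(ℂ, Cn n) ω (Blowup c) := by
  refine isManifold_of_contDiffOn _ _ _ fun e e' he he' => ?_
  obtain ⟨e, h, rfl⟩ := exists_of_mem_atlas c he
  obtain ⟨e', h', rfl⟩ := exists_of_mem_atlas c he'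
  have := (compatible_of_mem_charts c h h').2
  simp only [modelWithCornersSelf_coe, modelWithCornersSelf_coe_symm, Set.range_id, Set.inter_univ,
    Function.id_comp, Function.comp_id, Set.preimage_id]
  exact this

theorem contMDiffOn_chart {e : PartialEquiv (Blowup c) (Cn n)} (he : e ∈ charts c) :
    ContMDiffOn 𝓘(ℂ, Cn n) 𝓘(ℂ, Cn n) ω e e.source :=
  contMDiffOn_of_mem_maximalAtlas (e := (core c).openPartialHomeomorph e he)
    (IsManifold.subset_maximalAtlas (Set.mem_iUnion₂.2 ⟨e, he, rfl⟩))

theorem contMDiffOn_chart_symm {e : PartialEquiv (Blowup c) (Cn n)} (he : e ∈ charts c) :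
    ContMDiffOn 𝓘(ℂ, Cn n) 𝓘(ℂ, Cn n) ω e.symm e.target :=
  contMDiffOn_symm_of_mem_maximalAtlas (e := (core c).openPartialHomeomorph e he)
    (IsManifold.subset_maximalAtlas (Set.mem_iUnion₂.2 ⟨e, he, rfl⟩))

theorem isOpen_source {e : PartialEquiv (Blowup c) (Cn n)} (he : e ∈ charts c) :
    IsOpen e.source :=
  (core c).open_source' he

/-- The projection of the blowup is holomorphic. -/
theorem contMDiff_proj : ContMDiff 𝓘(ℂ, Cn n) 𝓘(ℂ, Cn n) ω (proj c) := by
  intro q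
  obtain ⟨e, he, hq⟩ := exists_chart c q
  refine ContMDiffOn.contMDiffAt ?_ ((isOpen_source c he).mem_nhds hq)
  have h := contMDiffOn_chart c he
  rcases he with ⟨p, rfl⟩ | ⟨i, rfl⟩
  · have h2 := contMDiffOn_symm_of_mem_maximalAtlas (n := ω) (I := 𝓘(ℂ, Cn n))
      (IsManifold.chart_mem_maximalAtlas (I := 𝓘(ℂ, Cn n)) (n := ω) p.1)
    refine (h2.comp h fun q hq => ((awayChart c p).map_source hq).1).congr fun q hq => ?_
    exact ((chartAt (Cn n) p.1).left_inv hq.2).symm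
  · have h2 := contMDiffOn_symm_of_mem_maximalAtlas (n := ω) c.mem_maximalAtlas
    have h3 : ContMDiffOn 𝓘(ℂ, Cn n) 𝓘(ℂ, Cn n) ω (fun q => down i (affineChart c i q))
        (affineChart c i).source := (contDiff_down i).contMDiff.comp_contMDiffOn h
    refine (h2.comp h3 fun q hq => (affineChart c i).map_source hq).congr fun q hq => ?_
    change proj c q = c.chart.symm (down i (affineFun c i q))
    rw [down_affineFun hq.1 hq.2]
    exact (c.chart.left_inv hq.1).symm

end

end Blowup

/-! ### Holomorphic line bundles -/

/-- A holomorphic line bundle on `X`: a family of complex vector spaces together with local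
trivialisations `L|_U ≅ U × ℂ`, linear on the fibres, over the members of an open cover, such that
the transition functions are holomorphic. -/
structure HolLineBundle (n : ℕ) (X : Type u) [TopologicalSpace X] [ChartedSpace (Cn n) X] where
  /-- the fibre over a point -/
  Fiber : X → Type v
  [addCommGroup : ∀ x, AddCommGroup (Fiber x)]
  [module : ∀ x, Module ℂ (Fiber x)]
  /-- the index set of the trivialising cover -/
  ι : Type w
  /-- the members of the trivialising cover -/
  baseSet : ι → Set X
  isOpen_baseSet : ∀ i, IsOpen (baseSet i)
  exists_mem_baseSet : ∀ x, ∃ i, x ∈ baseSet i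
  /-- the trivialisation with index `i`, only meaningful over `baseSet i` -/
  triv : ∀ i x, Fiber x →ₗ[ℂ] ℂ
  triv_bijective : ∀ i, ∀ x ∈ baseSet i, Function.Bijective (triv i x)
  exists_transition : ∀ i j, ∃ g : X → ℂ,
    ContMDiffOn 𝓘(ℂ, Cn n) 𝓘(ℂ, ℂ) ω g (baseSet i ∩ baseSet j) ∧
      ∀ x ∈ baseSet i ∩ baseSet j, ∀ v, triv i x v = g x * triv j x v

attribute [instance] HolLineBundle.addCommGroup HolLineBundle.module

namespace HolLineBundle

variable {X : Type u} [TopologicalSpace X] [ChartedSpace (Cn n) X]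

/-- An isomorphism of holomorphic line bundles over the identity: fibrewise linear isomorphisms
which are holomorphic (and thus biholomorphic) in the local trivialisations. -/
structure Iso (L : HolLineBundle.{u, v, w} n X) (L' : HolLineBundle.{u, v', w'} n X) where
  /-- the isomorphism of the fibres -/
  equiv : ∀ x, L.Fiber x ≃ₗ[ℂ] L'.Fiber x
  holomorphic : ∀ i j, ∃ h : X → ℂ,
    ContMDiffOn 𝓘(ℂ, Cn n) 𝓘(ℂ, ℂ) ω h (L.baseSet i ∩ L'.baseSet j) ∧
      ∀ x ∈ L.baseSet i ∩ L'.baseSet j, ∀ v, L'.triv j x (equiv x v) = h x * L.triv i x v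

/-- The tensor product of two holomorphic line bundles. -/
def tensor (L L' : HolLineBundle n X) : HolLineBundle n X where
  Fiber x := TensorProduct ℂ (L.Fiber x) (L'.Fiber x)
  ι := L.ι × L'.ι
  baseSet i := L.baseSet i.1 ∩ L'.baseSet i.2
  isOpen_baseSet i := (L.isOpen_baseSet i.1).inter (L'.isOpen_baseSet i.2)
  exists_mem_baseSet x := by
    obtain ⟨i, hi⟩ := L.exists_mem_baseSet x
    obtain ⟨j, hj⟩ := L'.exists_mem_baseSet x
    exact ⟨(i, j), hi, hj⟩
  triv i x := (TensorProduct.lid ℂ ℂ).toLinearMap ∘ₗ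
    TensorProduct.map (L.triv i.1 x) (L'.triv i.2 x)
  triv_bijective i x hx := by
    let e := LinearEquiv.ofBijective _ (L.triv_bijective i.1 x hx.1)
    let e' := LinearEquiv.ofBijective _ (L'.triv_bijective i.2 x hx.2)
    exact ((TensorProduct.congr e e').trans (TensorProduct.lid ℂ ℂ)).bijective
  exists_transition i j := by
    obtain ⟨g, hg, h⟩ := L.exists_transition i.1 j.1
    obtain ⟨g', hg', h'⟩ := L'.exists_transition i.2 j.2
    refine ⟨fun x => g x * g' x, ?_, ?_⟩
    · exact (hg.mono fun x hx => ⟨hx.1.1, hx.2.1⟩).mul (hg'.mono fun x hx => ⟨hx.1.2, hx.2.2⟩)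
    · intro x hx v
      induction v with
      | zero => simp
      | add a b ha hb => rw [map_add, map_add, ha, hb, mul_add]
      | tmul a b =>
        simp only [LinearMap.comp_apply, TensorProduct.map_tmul, LinearEquiv.coe_coe,
          TensorProduct.lid_tmul, smul_eq_mul]
        rw [h x ⟨hx.1.1, hx.2.1⟩, h' x ⟨hx.1.2, hx.2.2⟩]
        ring

/-- The pullback `f^*L` of a holomorphic line bundle under a holomorphic map. -/
def pullback {m : ℕ} {Y : Type u} [TopologicalSpace Y] [ChartedSpace (Cn m) Y]
    (L : HolLineBundle n X) (f : Y → X) (hf : ContMDiff 𝓘(ℂ, Cn m) 𝓘(ℂ, Cn n) ω f) :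
    HolLineBundle m Y where
  Fiber y := L.Fiber (f y)
  ι := L.ι
  baseSet i := f ⁻¹' L.baseSet i
  isOpen_baseSet i := (L.isOpen_baseSet i).preimage hf.continuous
  exists_mem_baseSet y := L.exists_mem_baseSet (f y)
  triv i y := L.triv i (f y)
  triv_bijective i y hy := L.triv_bijective i (f y) hy
  exists_transition i j := by
    obtain ⟨g, hg, h⟩ := L.exists_transition i j
    exact ⟨fun y => g (f y), hg.comp hf.contMDiffOn fun _ hy => hy, fun y hy v => h (f y) hy v⟩

end HolLineBundle

/-! ### The canonical bundle -/

section canonical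

variable (n) (X : Type u) [TopologicalSpace X] [ChartedSpace (Cn n) X]

/-- The coordinate vector field `∂/∂z_k` of the chart `e` at the point `x`. -/
def coordVector {n : ℕ} {X : Type u} [TopologicalSpace X] [ChartedSpace (Cn n) X]
    (e : OpenPartialHomeomorph X (Cn n)) (x : X) (k : Fin n) : TangentSpace 𝓘(ℂ, Cn n) x :=
  mfderiv 𝓘(ℂ, Cn n) 𝓘(ℂ, Cn n) e.symm (e x) (Pi.single k (1 : ℂ))

theorem coordVector_eq {n : ℕ} {X : Type u} [TopologicalSpace X] [ChartedSpace (Cn n) X]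
    [IsManifold 𝓘(ℂ, Cn n) ω X] {e e' : OpenPartialHomeomorph X (Cn n)}
    (he : e ∈ atlas (Cn n) X) (he' : e' ∈ atlas (Cn n) X) {x : X} (hx : x ∈ e.source)
    (hx' : x ∈ e'.source) (k : Fin n) :
    coordVector e x k = mfderiv 𝓘(ℂ, Cn n) 𝓘(ℂ, Cn n) e'.symm (e' x)
      (fderiv ℂ (fun w => e' (e.symm w)) (e x) (Pi.single k 1)) := by
  have h1 := mdifferentiableAt_atlas_symm (I := 𝓘(ℂ, Cn n)) he (e.map_source hx)
  have h2 := mdifferentiableAt_atlas (I := 𝓘(ℂ, Cn n)) he' hx'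
  have h3 := mdifferentiableAt_atlas_symm (I := 𝓘(ℂ, Cn n)) he' (e'.map_source hx')
  have h2' : MDifferentiableAt 𝓘(ℂ, Cn n) 𝓘(ℂ, Cn n) e' (e.symm (e x)) := by
    rwa [e.left_inv hx]
  have h12 := h2'.comp (e x) h1
  have h3' : MDifferentiableAt 𝓘(ℂ, Cn n) 𝓘(ℂ, Cn n) e'.symm ((e' ∘ e.symm) (e x)) := by
    simpa [e.left_inv hx] using h3
  have h := mfderiv_comp (e x) h3' h12
  have heq : (e'.symm ∘ (e' ∘ e.symm)) =ᶠ[nhds (e x)] e.symm := by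
    have : e.target ∩ e.symm ⁻¹' e'.source ∈ nhds (e x) :=
      (e.isOpen_inter_preimage_symm e'.open_source).mem_nhds
        ⟨e.map_source hx, by simpa [e.left_inv hx] using hx'⟩
    filter_upwards [this] with w hw
    exact e'.left_inv hw.2
  rw [heq.mfderiv_eq, mfderiv_eq_fderiv] at h
  have h4 : (e' ∘ e.symm) (e x) = e' x := by simp [e.left_inv hx]
  unfold coordVector
  rw [h]
  exact congrArg (fun y => (show Cn n →L[ℂ] Cn n from
    mfderiv 𝓘(ℂ, Cn n) 𝓘(ℂ, Cn n) e'.symm y)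
      (fderiv ℂ (fun w => e' (e.symm w)) (e x) (Pi.single k 1))) h4

theorem mfderiv_symm_bijective {n : ℕ} {X : Type u} [TopologicalSpace X] [ChartedSpace (Cn n) X]
    [IsManifold 𝓘(ℂ, Cn n) ω X] {e : OpenPartialHomeomorph X (Cn n)}
    (he : e ∈ atlas (Cn n) X) {x : X} (hx : x ∈ e.source) :
    Function.Bijective (mfderiv 𝓘(ℂ, Cn n) 𝓘(ℂ, Cn n) e.symm (e x)) :=
  (mdifferentiable_of_mem_atlas (I := 𝓘(ℂ, Cn n)) he).symm.mfderiv_bijective (e.map_source hx)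

/-- The coordinate vector fields form a basis of each tangent space. -/
def coordBasis {n : ℕ} {X : Type u} [TopologicalSpace X] [ChartedSpace (Cn n) X]
    [IsManifold 𝓘(ℂ, Cn n) ω X] {e : OpenPartialHomeomorph X (Cn n)}
    (he : e ∈ atlas (Cn n) X) {x : X} (hx : x ∈ e.source) :
    Module.Basis (Fin n) ℂ (TangentSpace 𝓘(ℂ, Cn n) x) :=
  (Pi.basisFun ℂ (Fin n)).map (LinearEquiv.ofBijective
    (show Cn n →ₗ[ℂ] TangentSpace 𝓘(ℂ, Cn n) x from
      (mfderiv 𝓘(ℂ, Cn n) 𝓘(ℂ, Cn n) e.symm (e x)).toLinearMap) (mfderiv_symm_bijective he hx))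

theorem coordBasis_apply {n : ℕ} {X : Type u} [TopologicalSpace X] [ChartedSpace (Cn n) X]
    [IsManifold 𝓘(ℂ, Cn n) ω X] {e : OpenPartialHomeomorph X (Cn n)}
    (he : e ∈ atlas (Cn n) X) {x : X} (hx : x ∈ e.source) :
    (coordBasis he hx : Fin n → TangentSpace 𝓘(ℂ, Cn n) x) = coordVector e x := by
  funext k
  simp only [coordBasis, Module.Basis.map_apply, Pi.basisFun_apply]
  rfl

/-- The Jacobian determinant of the coordinate change from `e` to `e'`. -/
def jacobian {n : ℕ} {X : Type u} [TopologicalSpace X] [ChartedSpace (Cn n) X]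
    (e e' : OpenPartialHomeomorph X (Cn n)) (x : X) : ℂ :=
  Matrix.det (Matrix.of fun a b : Fin n =>
    fderiv ℂ (fun w => e' (e.symm w)) (e x) (Pi.single b 1) a)

theorem alternatingMap_coordVector {n : ℕ} {X : Type u} [TopologicalSpace X]
    [ChartedSpace (Cn n) X] [IsManifold 𝓘(ℂ, Cn n) ω X] {e e' : OpenPartialHomeomorph X (Cn n)}
    (he : e ∈ atlas (Cn n) X) (he' : e' ∈ atlas (Cn n) X) {x : X} (hx : x ∈ e.source)
    (hx' : x ∈ e'.source) (α : TangentSpace 𝓘(ℂ, Cn n) x [⋀^Fin n]→ₗ[ℂ] ℂ) :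
    α (coordVector e x) = jacobian e e' x * α (coordVector e' x) := by
  let A : Cn n →ₗ[ℂ] TangentSpace 𝓘(ℂ, Cn n) x :=
    (mfderiv 𝓘(ℂ, Cn n) 𝓘(ℂ, Cn n) e'.symm (e' x)).toLinearMap
  let J : Cn n →ₗ[ℂ] Cn n := (fderiv ℂ (fun w => e' (e.symm w)) (e x)).toLinearMap
  let b := Pi.basisFun ℂ (Fin n)
  have h1 : coordVector e x = fun k => A ((J ∘ b) k) := by
    funext k
    rw [coordVector_eq he he' hx hx' k]
    simp only [b, Function.comp_apply, Pi.basisFun_apply]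
    rfl
  have h2 : coordVector e' x = fun k => A (b k) := by
    funext k
    simp only [b, Pi.basisFun_apply]
    rfl
  have h3 : α (coordVector e x) = α.compLinearMap A (J ∘ b) := by rw [h1]; rfl
  have h4 : α (coordVector e' x) = α.compLinearMap A b := by rw [h2]; rfl
  have h5 : LinearMap.det J = jacobian e e' x := by
    rw [← LinearMap.det_toMatrix', jacobian]
    congr 1
  rw [h3, h4, AlternatingMap.eq_smul_basis_det b (α.compLinearMap A)]
  simp only [AlternatingMap.smul_apply, Module.Basis.det_comp, Module.Basis.det_self, smul_eq_mul,
    mul_one, h5]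
  exact mul_comm _ _

theorem contMDiffOn_jacobian {n : ℕ} {X : Type u} [TopologicalSpace X]
    [ChartedSpace (Cn n) X] [IsManifold 𝓘(ℂ, Cn n) ω X] {e e' : OpenPartialHomeomorph X (Cn n)}
    (he : e ∈ atlas (Cn n) X) (he' : e' ∈ atlas (Cn n) X) :
    ContMDiffOn 𝓘(ℂ, Cn n) 𝓘(ℂ, ℂ) ω (jacobian e e') (e.source ∩ e'.source) := by
  have hm := IsManifold.subset_maximalAtlas (I := 𝓘(ℂ, Cn n)) (n := ω) he
  have hm' := IsManifold.subset_maximalAtlas (I := 𝓘(ℂ, Cn n)) (n := ω) he'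
  have h1 := Blowup.contDiffOn_coordChange hm hm'
  have hU : IsOpen (e.target ∩ e.symm ⁻¹' e'.source) :=
    e.isOpen_inter_preimage_symm e'.open_source
  have h2 : ContDiffOn ℂ ω (fun w => fderiv ℂ (fun w => e' (e.symm w)) w)
      (e.target ∩ e.symm ⁻¹' e'.source) := h1.fderiv_of_isOpen hU (by simp)
  have h3 : ContDiffOn ℂ ω (fun w => Matrix.det (Matrix.of fun a b : Fin n =>
      fderiv ℂ (fun w => e' (e.symm w)) w (Pi.single b 1) a))
      (e.target ∩ e.symm ⁻¹' e'.source) := by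
    simp only [Matrix.det_apply, Matrix.of_apply]
    refine ContDiffOn.sum fun σ _ => ContDiffOn.const_smul _ ?_
    refine contDiffOn_prod fun a _ => ?_
    exact contDiffOn_pi.1 (h2.clm_apply contDiffOn_const) _
  refine h3.contMDiffOn.comp ((contMDiffOn_of_mem_maximalAtlas hm).mono Set.inter_subset_left) ?_
  intro x hx
  exact ⟨e.map_source hx.1, by simpa [e.left_inv hx.1] using hx.2⟩

/-- The canonical bundle `K_X`: the fibre at `x` consists of the alternating `n`-forms on the
tangent space at `x`. Local coordinates `z` trivialise it by means of the frame `dz₁ ∧ ⋯ ∧ dzₙ`,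
that is, the coordinate of a form is its value on `(∂/∂z₁, …, ∂/∂zₙ)`. -/
def canonicalBundle [IsManifold 𝓘(ℂ, Cn n) ω X] : HolLineBundle n X where
  Fiber x := TangentSpace 𝓘(ℂ, Cn n) x [⋀^Fin n]→ₗ[ℂ] ℂ
  ι := {e : OpenPartialHomeomorph X (Cn n) // e ∈ atlas (Cn n) X}
  baseSet e := e.1.source
  isOpen_baseSet e := e.1.open_source
  exists_mem_baseSet x := ⟨⟨chartAt (Cn n) x, chart_mem_atlas (Cn n) x⟩, mem_chart_source (Cn n) x⟩
  triv e x :=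
    { toFun := fun α => α (coordVector e.1 x)
      map_add' := fun _ _ => rfl
      map_smul' := fun _ _ => rfl }
  triv_bijective e x hx := by
    have hb := coordBasis_apply e.2 hx
    constructor
    · intro α β h
      change α (coordVector e.1 x) = β (coordVector e.1 x) at h
      rw [AlternatingMap.eq_smul_basis_det (coordBasis e.2 hx) α,
        AlternatingMap.eq_smul_basis_det (coordBasis e.2 hx) β, hb, h]
    · intro a
      refine ⟨a • (coordBasis e.2 hx).det, ?_⟩
      change a • (coordBasis e.2 hx).det (coordVector e.1 x) = a
      rw [← hb, Module.Basis.det_self, smul_eq_mul, mul_one]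
  exists_transition e e' := ⟨jacobian e.1 e'.1, contMDiffOn_jacobian e.2 e'.2,
    fun _ hx α => alternatingMap_coordVector e.2 e'.2 hx.1 hx.2 α⟩

end canonical

/-! ### Divisors and their line bundles -/

/-- Local defining functions of a smooth hypersurface `V`, regarded as a divisor with multiplicity
one: holomorphic functions `fᵢ` on the members `Uᵢ` of an open cover whose zero set is `V ∩ Uᵢ`,
which vanish to first order along `V`, and whose ratios `fᵢ / fⱼ` are (that is, extend to)
holomorphic functions on `Uᵢ ∩ Uⱼ`. -/
structure LocalEquations (n : ℕ) {X : Type u} [TopologicalSpace X] [ChartedSpace (Cn n) X]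
    (V : Set X) where
  /-- the index set of the cover -/
  ι : Type w
  /-- the members of the cover -/
  baseSet : ι → Set X
  isOpen_baseSet : ∀ i, IsOpen (baseSet i)
  exists_mem_baseSet : ∀ x, ∃ i, x ∈ baseSet i
  /-- the local defining function on `baseSet i` -/
  f : ι → X → ℂ
  contMDiffOn_f : ∀ i, ContMDiffOn 𝓘(ℂ, Cn n) 𝓘(ℂ, ℂ) ω (f i) (baseSet i)
  f_eq_zero_iff : ∀ i, ∀ x ∈ baseSet i, f i x = 0 ↔ x ∈ V
  mfderiv_f_ne_zero : ∀ i, ∀ x ∈ baseSet i, x ∈ V → mfderiv 𝓘(ℂ, Cn n) 𝓘(ℂ, ℂ) (f i) x ≠ 0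
  /-- the ratio `fᵢ / fⱼ` on `baseSet i ∩ baseSet j` -/
  ratio : ι → ι → X → ℂ
  contMDiffOn_ratio : ∀ i j,
    ContMDiffOn 𝓘(ℂ, Cn n) 𝓘(ℂ, ℂ) ω (ratio i j) (baseSet i ∩ baseSet j)
  f_eq_ratio_mul : ∀ i j, ∀ x ∈ baseSet i ∩ baseSet j, f i x = ratio i j x * f j x

namespace LocalEquations

variable {X : Type u} [TopologicalSpace X] [ChartedSpace (Cn n) X] {V : Set X}
  (D : LocalEquations.{u, w} n V)

theorem eq_of_mul_f_eq {i : D.ι} {W : Set X} (hW : IsOpen W) (hWi : W ⊆ D.baseSet i) {a b : X → ℂ}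
    (ha : ContinuousOn a W) (hb : ContinuousOn b W) (h : ∀ x ∈ W, a x * D.f i x = b x * D.f i x)
    {x : X} (hx : x ∈ W) : a x = b x := by
  by_contra hne
  have h1 : ∀ᶠ y in nhds x, a y ≠ b y :=
    ((ha.continuousAt (hW.mem_nhds hx)).prodMk (hb.continuousAt (hW.mem_nhds hx))).eventually
      ((isClosed_diagonal (X := ℂ)).isOpen_compl.mem_nhds hne)
  have h2 : D.f i =ᶠ[nhds x] fun _ => 0 := by
    filter_upwards [h1, hW.mem_nhds hx] with y hy hyW
    by_contra h0
    exact hy (mul_right_cancel₀ h0 (h y hyW))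
  have h3 : x ∈ V := (D.f_eq_zero_iff i x (hWi hx)).1 h2.self_of_nhds
  refine D.mfderiv_f_ne_zero i x (hWi hx) h3 ?_
  rw [h2.mfderiv_eq]
  exact mfderiv_const

theorem ratio_self (i : D.ι) {x : X} (hx : x ∈ D.baseSet i) : D.ratio i i x = 1 := by
  refine D.eq_of_mul_f_eq (b := fun _ => 1) (D.isOpen_baseSet i) subset_rfl
    ((D.contMDiffOn_ratio i i).continuousOn.mono fun y hy => ⟨hy, hy⟩) continuousOn_const
    (fun y hy => ?_) hx
  rw [← D.f_eq_ratio_mul i i y ⟨hy, hy⟩, one_mul]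

theorem ratio_mul_ratio (i j k : D.ι) {x : X} (hi : x ∈ D.baseSet i) (hj : x ∈ D.baseSet j)
    (hk : x ∈ D.baseSet k) : D.ratio i j x * D.ratio j k x = D.ratio i k x := by
  refine D.eq_of_mul_f_eq (i := k) (a := fun x => D.ratio i j x * D.ratio j k x)
    (W := D.baseSet i ∩ D.baseSet j ∩ D.baseSet k)
    (((D.isOpen_baseSet i).inter (D.isOpen_baseSet j)).inter (D.isOpen_baseSet k))
    Set.inter_subset_right ?_ ?_ ?_ ⟨⟨hi, hj⟩, hk⟩
  · exact ((D.contMDiffOn_ratio i j).continuousOn.mono fun y hy => hy.1).mul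
      ((D.contMDiffOn_ratio j k).continuousOn.mono fun y hy => ⟨hy.1.2, hy.2⟩)
  · exact (D.contMDiffOn_ratio i k).continuousOn.mono fun y hy => ⟨hy.1.1, hy.2⟩
  · intro y hy
    rw [mul_assoc, ← D.f_eq_ratio_mul j k y ⟨hy.1.2, hy.2⟩, ← D.f_eq_ratio_mul i j y hy.1,
      ← D.f_eq_ratio_mul i k y ⟨hy.1.1, hy.2⟩]

theorem ratio_ne_zero (i j : D.ι) {x : X} (hi : x ∈ D.baseSet i) (hj : x ∈ D.baseSet j) :
    D.ratio i j x ≠ 0 := by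
  intro h
  have := D.ratio_mul_ratio i j i hi hj hi
  rw [h, zero_mul, D.ratio_self i hi] at this
  exact zero_ne_one this

theorem contMDiffOn_ratio_zpow (i j : D.ι) (k : ℤ) :
    ContMDiffOn 𝓘(ℂ, Cn n) 𝓘(ℂ, ℂ) ω (fun x => D.ratio i j x ^ k)
      (D.baseSet i ∩ D.baseSet j) := by
  obtain ⟨m, rfl | rfl⟩ := k.eq_nat_or_neg
  · simp only [zpow_natCast]
    exact (D.contMDiffOn_ratio i j).pow m
  · simp only [zpow_neg, zpow_natCast]
    exact ((D.contMDiffOn_ratio i j).pow m).inv₀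
      fun x hx => pow_ne_zero _ (D.ratio_ne_zero i j hx.1 hx.2)

/-- A member of the cover containing the point `x`. -/
def indexAt (x : X) : D.ι := (D.exists_mem_baseSet x).choose

theorem mem_indexAt (x : X) : x ∈ D.baseSet (D.indexAt x) := (D.exists_mem_baseSet x).choose_spec

/-- The line bundle `[k V]` associated to the divisor `k V` with local defining functions `fᵢᵏ`: it
is trivial over the `Uᵢ` and has the transition functions `fᵢᵏ / fⱼᵏ`. The fibre over `x` is
identified with `ℂ` through the trivialisation with index `indexAt x`. -/
def lineBundle (k : ℤ) : HolLineBundle n X where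
  Fiber _ := ℂ
  ι := D.ι
  baseSet := D.baseSet
  isOpen_baseSet := D.isOpen_baseSet
  exists_mem_baseSet := D.exists_mem_baseSet
  triv i x := (D.ratio i (D.indexAt x) x ^ k) • LinearMap.id
  triv_bijective i x hx := by
    have h := zpow_ne_zero k (D.ratio_ne_zero i (D.indexAt x) hx (D.mem_indexAt x))
    exact (LinearEquiv.smulOfNeZero ℂ ℂ _ h).bijective
  exists_transition i j := by
    refine ⟨fun x => D.ratio i j x ^ k, D.contMDiffOn_ratio_zpow i j k, fun x hx v => ?_⟩
    simp only [LinearMap.smul_apply, LinearMap.id_apply, smul_eq_mul]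
    rw [← D.ratio_mul_ratio i j (D.indexAt x) hx.1 hx.2 (D.mem_indexAt x), mul_zpow, mul_assoc]

end LocalEquations

namespace Blowup

variable {x : M} (c : LocalCoord n x)

/-- The exceptional divisor `E = π⁻¹(x)` as a set. -/
def exceptionalSet : Set (Blowup c) := proj c ⁻¹' {x}

/-- The open cover of the blowup by the complement of `E` and the domains of the affine charts. -/
def excBaseSet : Option (Fin n) → Set (Blowup c)
  | none => (exceptionalSet c)ᶜ
  | some i => (affineChart c i).source

/-- The local defining functions of `E`: the function `1` on the complement of `E`, and `zᵢⁱ = zᵢ`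
in the `i`-th affine chart. -/
def excFun : Option (Fin n) → Blowup c → ℂ
  | none, _ => 1
  | some i, q => c.chart (proj c q) i

/-- The ratios of the local defining functions of `E`. -/
def excRatio : Option (Fin n) → Option (Fin n) → Blowup c → ℂ
  | none, none, _ => 1
  | none, some j, q => (c.chart (proj c q) j)⁻¹
  | some i, none, q => c.chart (proj c q) i
  | some i, some j, q => dir c q i / dir c q j

theorem excFun_some_eq (i : Fin n) (q : Blowup c) :
    excFun c (some i) q = affineChart c i q i := by
  change c.chart (proj c q) i = affineFun c i q i
  simp [affineFun]

theorem excFun_some_eq_zero_iff (i : Fin n) (q : Blowup c) (hq : q ∈ (affineChart c i).source) :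
    excFun c (some i) q = 0 ↔ q ∈ exceptionalSet c := by
  rcases q with ⟨p, hp⟩ | l
  · have h1 : c.chart p i ≠ 0 := hq.2
    exact ⟨fun h => absurd h h1, fun h => absurd h hp⟩
  · refine ⟨fun _ => rfl, fun _ => ?_⟩
    simp [excFun, proj, c.map_zero]

section
variable [IsManifold 𝓘(ℂ, Cn n) ω M]

theorem contMDiffOn_affineChart_apply (i j : Fin n) :
    ContMDiffOn 𝓘(ℂ, Cn n) 𝓘(ℂ, ℂ) ω (fun q => affineChart c i q j) (affineChart c i).source := by
  have h : ContDiff ℂ ω fun w : Cn n => w j := by fun_prop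
  exact h.contMDiff.comp_contMDiffOn (contMDiffOn_chart c (Or.inr ⟨i, rfl⟩))

theorem contMDiffOn_excFun (i : Option (Fin n)) :
    ContMDiffOn 𝓘(ℂ, Cn n) 𝓘(ℂ, ℂ) ω (excFun c i) (excBaseSet c i) := by
  rcases i with _ | i
  · exact contMDiffOn_const
  · exact (contMDiffOn_affineChart_apply c i i).congr fun q _ => excFun_some_eq c i q

theorem contMDiffOn_excRatio (i j : Option (Fin n)) :
    ContMDiffOn 𝓘(ℂ, Cn n) 𝓘(ℂ, ℂ) ω (excRatio c i j) (excBaseSet c i ∩ excBaseSet c j) := by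
  rcases i with _ | i <;> rcases j with _ | j
  · exact contMDiffOn_const
  · exact ((contMDiffOn_excFun c (some j)).mono Set.inter_subset_right).inv₀
      fun q hq h => hq.1 ((excFun_some_eq_zero_iff c j q hq.2).1 h)
  · exact (contMDiffOn_excFun c (some i)).mono Set.inter_subset_left
  · by_cases hij : i = j
    · subst hij
      exact (contMDiffOn_const (c := (1 : ℂ))).congr fun q hq => div_self hq.1.2
    · refine ((contMDiffOn_affineChart_apply c j i).mono Set.inter_subset_right).congr
        fun q hq => ?_
      change dir c q i / dir c q j = affineFun c j q i
      simp [affineFun, hij]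

theorem mfderiv_excFun_ne_zero (i : Fin n) (q : Blowup c) (hq : q ∈ (affineChart c i).source) :
    mfderiv 𝓘(ℂ, Cn n) 𝓘(ℂ, ℂ) (excFun c (some i)) q ≠ 0 := by
  let e := (core c).openPartialHomeomorph (affineChart c i) (Or.inr ⟨i, rfl⟩)
  have he : e ∈ atlas (Cn n) (Blowup c) := Set.mem_iUnion₂.2 ⟨_, Or.inr ⟨i, rfl⟩, rfl⟩
  have hd : e.MDifferentiable 𝓘(ℂ, Cn n) 𝓘(ℂ, Cn n) := mdifferentiable_of_mem_atlas he
  have heq : excFun c (some i) =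
      (ContinuousLinearMap.proj (R := ℂ) (φ := fun _ : Fin n => ℂ) i) ∘ e :=
    funext fun q => excFun_some_eq c i q
  obtain ⟨v, hv⟩ := (hd.mfderiv_bijective hq).2 (Pi.single i (1 : ℂ) : Cn n)
  intro h0
  have h1 := mfderiv_comp q
    (ContinuousLinearMap.mdifferentiableAt
      (ContinuousLinearMap.proj (R := ℂ) (φ := fun _ : Fin n => ℂ) i)) (hd.mdifferentiableAt hq)
  rw [← heq, h0] at h1
  have h2 := DFunLike.congr_fun h1 v
  rw [ContinuousLinearMap.mfderiv_eq] at h2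
  change (0 : ℂ) = (mfderiv 𝓘(ℂ, Cn n) 𝓘(ℂ, Cn n) e q v : Cn n) i at h2
  rw [hv] at h2
  simp at h2

/-- The exceptional divisor `E = π⁻¹(x)` with its local defining functions. -/
def exceptionalDivisor : LocalEquations n (exceptionalSet c) where
  ι := Option (Fin n)
  baseSet := excBaseSet c
  isOpen_baseSet i := by
    have : T1Space M := ChartedSpace.t1Space (Cn n) M
    rcases i with _ | i
    · exact (isClosed_singleton.preimage (contMDiff_proj c).continuous).isOpen_compl
    · exact isOpen_source c (Or.inr ⟨i, rfl⟩)
  exists_mem_baseSet q := by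
    rcases q with ⟨p, hp⟩ | l
    · exact ⟨none, hp⟩
    · obtain ⟨i, hi⟩ := Function.ne_iff.1 l.rep_nonzero
      exact ⟨some i, c.mem_source, hi⟩
  f := excFun c
  contMDiffOn_f := contMDiffOn_excFun c
  f_eq_zero_iff i q hq := by
    rcases i with _ | i
    · exact ⟨fun h => absurd h one_ne_zero, fun h => absurd h hq⟩
    · exact excFun_some_eq_zero_iff c i q hq
  mfderiv_f_ne_zero i q hq hE := by
    rcases i with _ | i
    · exact absurd hE hq
    · exact mfderiv_excFun_ne_zero c i q hq
  ratio := excRatio c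
  contMDiffOn_ratio := contMDiffOn_excRatio c
  f_eq_ratio_mul i j q hq := by
    rcases i with _ | i <;> rcases j with _ | j
    · simp [excFun, excRatio]
    · have h : excFun c (some j) q ≠ 0 :=
        fun h => hq.1 ((excFun_some_eq_zero_iff c j q hq.2).1 h)
      exact (inv_mul_cancel₀ h).symm
    · simp [excFun, excRatio]
    · have hj : dir c q j ≠ 0 := hq.2.2
      have h := (incidence_eq q hq.2.1).2 i j
      change c.chart (proj c q) i = dir c q i / dir c q j * c.chart (proj c q) j
      rw [div_mul_eq_mul_div, eq_div_iff hj, h, mul_comm]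

end

end Blowup

end KodairaBlowup

end

open KodairaBlowup

namespace KodairaBlowup

open scoped Topology

noncomputable section

universe u v w v' w' z

/-! ### Isomorphisms of line bundles given on a dense subset -/

namespace HolLineBundle

variable {n : ℕ} {X : Type u} [TopologicalSpace X] [ChartedSpace (Cn n) X]
  {L : HolLineBundle.{u, v, w} n X} {L' : HolLineBundle.{u, v', w'} n X}

/-! Pulling back `n`-forms along `π` should identify `π^*K_M` with `K` of the blowup up to the zeros
of the Jacobian of `π`. In the `i`-th affine coordinates `π` is `down i`, and row reduction gives
its Jacobian determinant as `wᵢⁿ⁻¹` (`det_fderiv_down`). Since `wᵢ` is the local equation of `E`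
there, the Jacobian is exactly the local equation of `(n-1)E`. Away from `E`, in the lifted charts,
`π` is the identity and the local equation is `1`.

Rather than comparing transition functions chart by chart, the proof uses density. On each set
`isoSet` of an open cover, a nonvanishing holomorphic function `isoFun` relates the trivialisations
of the two bundles. These local isomorphisms need to be matched only on a dense set, and there only
on one nonzero vector of each fibre (`nonempty_iso_of_dense`). The dense set is the complement of
`E`. There the matching vectors are `π^*β` and `β ⊗ s`, with `β` a nonzero `n`-form at the image
point and `s` the value of the section of `[(n-1)E]` given locally by the powers `fₖⁿ⁻¹`. That they
match in every chart is `pullback_coordVector_chartOf`.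

The given coordinates `z` need only lie in the maximal atlas, whereas `canonicalBundle` is
trivialised by charts of the atlas. The Jacobian between the two is the factor `isoFun` on the
affine charts. -/

/-- The linear isomorphism of a fibre with `ℂ` given by a local trivialisation. -/
def trivEquiv (L : HolLineBundle.{u, v, w} n X) {i : L.ι} {x : X} (hx : x ∈ L.baseSet i) :
    L.Fiber x ≃ₗ[ℂ] ℂ :=
  LinearEquiv.ofBijective _ (L.triv_bijective i x hx)

@[simp]
theorem trivEquiv_apply {i : L.ι} {x : X} (hx : x ∈ L.baseSet i) (v : L.Fiber x) :
    L.trivEquiv hx v = L.triv i x v := rfl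

/-- Holomorphic functions `hₖ` relating the trivialisations of `L` and `L'`, compatible with the
transition functions, define an isomorphism. -/
theorem nonempty_iso_of_compatible {κ : Type z} (W : κ → Set X) (a : κ → L.ι) (b : κ → L'.ι)
    (h : κ → X → ℂ) (hWo : ∀ k, IsOpen (W k)) (hW : ∀ x, ∃ k, x ∈ W k)
    (hWa : ∀ k, W k ⊆ L.baseSet (a k)) (hWb : ∀ k, W k ⊆ L'.baseSet (b k))
    (hh : ∀ k, ContMDiffOn 𝓘(ℂ, Cn n) 𝓘(ℂ, ℂ) ω (h k) (W k))
    (h0 : ∀ k, ∀ x ∈ W k, h k x ≠ 0)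
    (hcompat : ∀ k l, ∀ x ∈ W k ∩ W l, ∀ v v',
      L.triv (a k) x v = h k x * L'.triv (b k) x v' →
        L.triv (a l) x v = h l x * L'.triv (b l) x v') :
    Nonempty (Iso L L') := by
  -- The fibre map at `x` is defined through an arbitrarily chosen index `k x`, which need not vary
  -- continuously with `x`.
  choose k hk using hW
  let φ : ∀ x, L.Fiber x ≃ₗ[ℂ] L'.Fiber x := fun x =>
    ((L.trivEquiv (hWa _ (hk x))).trans
      (LinearEquiv.smulOfNeZero ℂ ℂ _ (inv_ne_zero (h0 _ x (hk x))))).trans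
      (L'.trivEquiv (hWb _ (hk x))).symm
  have hφ : ∀ x v, L'.triv (b (k x)) x (φ x v) = (h (k x) x)⁻¹ * L.triv (a (k x)) x v := by
    intro x v
    exact (L'.trivEquiv (hWb _ (hk x))).apply_symm_apply _
  -- Compatibility removes the dependence on the choice: the same formula holds for every index
  -- whose set contains `x`.
  have hφ' : ∀ l, ∀ x ∈ W l, ∀ v, L'.triv (b l) x (φ x v) = (h l x)⁻¹ * L.triv (a l) x v := by
    intro l x hx v
    have h1 := hcompat (k x) l x ⟨hk x, hx⟩ v (φ x v) (by
      rw [hφ, mul_inv_cancel_left₀ (h0 _ x (hk x))])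
    rw [h1, inv_mul_cancel_left₀ (h0 _ x hx)]
  refine ⟨⟨φ, fun i j => ?_⟩⟩
  classical
  -- The coefficient of `φ` is read off on the vector with coordinate `1`; the value `0` off
  -- `baseSet i` plays no role.
  let H : X → ℂ := fun x =>
    if hx : x ∈ L.baseSet i then L'.triv j x (φ x ((L.trivEquiv hx).symm 1)) else 0
  have hH : ∀ x ∈ L.baseSet i, ∀ v, L'.triv j x (φ x v) = H x * L.triv i x v := by
    intro x hx v
    have h1 : v = L.triv i x v • (L.trivEquiv hx).symm 1 := by
      rw [← map_smul, smul_eq_mul, mul_one]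
      exact ((L.trivEquiv hx).symm_apply_apply v).symm
    conv_lhs => rw [h1]
    simp only [H, dif_pos hx, map_smul, smul_eq_mul]
    exact mul_comm _ _
  refine ⟨H, ?_, fun x hx v => hH x hx.1 v⟩
  intro x hx
  obtain ⟨g, hg, hgt⟩ := L.exists_transition (a (k x)) i
  obtain ⟨g', hg', hgt'⟩ := L'.exists_transition j (b (k x))
  have hmem : L.baseSet i ∩ L'.baseSet j ∩ W (k x) ∈ 𝓝 x :=
    (((L.isOpen_baseSet i).inter (L'.isOpen_baseSet j)).inter (hWo _)).mem_nhds ⟨hx, hk x⟩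
  -- Near `x` the index is frozen at `k x`, so `H` becomes a product of transition functions with
  -- the inverse of a single `h`.
  have h1 : ContMDiffOn 𝓘(ℂ, Cn n) 𝓘(ℂ, ℂ) ω (fun y => g' y * (h (k x) y)⁻¹ * g y)
      (L.baseSet i ∩ L'.baseSet j ∩ W (k x)) :=
    ((hg'.mono fun y hy => ⟨hy.1.2, hWb _ hy.2⟩).mul
      (((hh (k x)).inv₀ (h0 (k x))).mono fun y hy => hy.2)).mul
        (hg.mono fun y hy => ⟨hWa _ hy.2, hy.1.1⟩)
  refine ((h1.congr fun y hy => ?_).contMDiffAt hmem).contMDiffWithinAt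
  have h2 := hH y hy.1.1 ((L.trivEquiv hy.1.1).symm 1)
  have h3 : L.triv i y ((L.trivEquiv hy.1.1).symm 1) = 1 :=
    (L.trivEquiv hy.1.1).apply_symm_apply 1
  rw [h3, mul_one] at h2
  rw [← h2, hgt' y ⟨hy.1.2, hWb _ hy.2⟩, hφ' (k x) y hy.2, hgt y ⟨hWa _ hy.2, hy.1.1⟩, h3, mul_one,
    mul_assoc]

/-- It suffices to check compatibility of local isomorphisms on a dense set, and there on a single
nonzero vector. -/
theorem nonempty_iso_of_dense {κ : Type z} (W : κ → Set X) (a : κ → L.ι) (b : κ → L'.ι)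
    (h : κ → X → ℂ) (hWo : ∀ k, IsOpen (W k)) (hW : ∀ x, ∃ k, x ∈ W k)
    (hWa : ∀ k, W k ⊆ L.baseSet (a k)) (hWb : ∀ k, W k ⊆ L'.baseSet (b k))
    (hh : ∀ k, ContMDiffOn 𝓘(ℂ, Cn n) 𝓘(ℂ, ℂ) ω (h k) (W k))
    (h0 : ∀ k, ∀ x ∈ W k, h k x ≠ 0) {D : Set X} (hD : Dense D)
    (hgen : ∀ x ∈ D, ∃ v v', v' ≠ 0 ∧
      ∀ k, x ∈ W k → L.triv (a k) x v = h k x * L'.triv (b k) x v') :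
    Nonempty (Iso L L') := by
  refine nonempty_iso_of_compatible W a b h hWo hW hWa hWb hh h0 ?_
  intro k l x hx v v' hv
  obtain ⟨g, hg, hgt⟩ := L.exists_transition (a l) (a k)
  obtain ⟨g', hg', hgt'⟩ := L'.exists_transition (b l) (b k)
  have ho : IsOpen (W k ∩ W l) := (hWo k).inter (hWo l)
  have hc : ContinuousOn (fun y => g y * h k y) (W k ∩ W l) :=
    (hg.continuousOn.mono fun y hy => ⟨hWa _ hy.2, hWa _ hy.1⟩).mul
      ((hh k).continuousOn.mono Set.inter_subset_left)
  have hc' : ContinuousOn (fun y => h l y * g' y) (W k ∩ W l) :=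
    ((hh l).continuousOn.mono Set.inter_subset_right).mul
      (hg'.continuousOn.mono fun y hy => ⟨hWb _ hy.2, hWb _ hy.1⟩)
  -- Compatibility of `k` with `l` amounts to this identity of functions. On `D` it follows by
  -- cancelling the nonzero coordinate of the test vector `u'`.
  have hDeq : Set.EqOn (fun y => g y * h k y) (fun y => h l y * g' y) (W k ∩ W l ∩ D) := by
    rintro y ⟨hy, hyD⟩
    obtain ⟨u, u', hu', hu⟩ := hgen y hyD
    have h1 := hu k hy.1
    have h2 := hu l hy.2
    rw [hgt y ⟨hWa _ hy.2, hWa _ hy.1⟩, hgt' y ⟨hWb _ hy.2, hWb _ hy.1⟩, h1] at h2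
    have h3 : L'.triv (b k) y u' ≠ 0 := fun h3 =>
      hu' ((L'.triv_bijective (b k) y (hWb _ hy.1)).1 (h3.trans (map_zero _).symm))
    refine mul_right_cancel₀ h3 ?_
    change g y * h k y * _ = h l y * g' y * _
    rw [mul_assoc, h2, mul_assoc]
  -- Both sides are continuous and `D` is dense in the open set `W k ∩ W l`, so the identity extends
  -- to all of it.
  have heq := hDeq.of_subset_closure hc hc' Set.inter_subset_left
    (hD.open_subset_closure_inter ho) hx
  change g x * h k x = h l x * g' x at heq
  rw [hgt x ⟨hWa _ hx.2, hWa _ hx.1⟩, hgt' x ⟨hWb _ hx.2, hWb _ hx.1⟩, hv, ← mul_assoc, heq,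
    mul_assoc]

end HolLineBundle

/-- Near an interior point of `V` a local equation would vanish identically, so the coefficients `0`
and `1` in front of it could not be told apart. This contradicts `eq_of_mul_f_eq`, which rests on
first-order vanishing along `V`. -/
theorem LocalEquations.dense_compl {n : ℕ} {X : Type u} [TopologicalSpace X]
    [ChartedSpace (Cn n) X] {V : Set X} (D : LocalEquations.{u, w} n V) : Dense Vᶜ := by
  rw [← interior_eq_empty_iff_dense_compl, Set.eq_empty_iff_forall_notMem]
  intro x hx
  refine zero_ne_one (α := ℂ) (D.eq_of_mul_f_eq (i := D.indexAt x) (a := fun _ => 0)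
    (b := fun _ => 1) (isOpen_interior.inter (D.isOpen_baseSet _)) Set.inter_subset_right
    continuousOn_const continuousOn_const (fun y hy => ?_) ⟨hx, D.mem_indexAt x⟩)
  rw [(D.f_eq_zero_iff _ y hy.2).2 (interior_subset hy.1), mul_zero, mul_zero]

/-! ### Jacobians of coordinate changes -/

section jacobian

variable {n : ℕ} {X : Type u} [TopologicalSpace X] [ChartedSpace (Cn n) X]

/-- Alternating `n`-forms on `ℂⁿ` are multiples of the determinant form, so precomposing with `J`
scales them by `det J`. Neither `A` nor `J` has to be invertible, which allows for the degeneration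
of `π` along `E`. -/
theorem alternatingMap_comp_eq_det {V : Type*} [AddCommGroup V] [Module ℂ V]
    (α : V [⋀^Fin n]→ₗ[ℂ] ℂ) (A : Cn n →ₗ[ℂ] V) (J : Cn n →ₗ[ℂ] Cn n) :
    α (fun k => A (J (Pi.single k 1))) =
      Matrix.det (Matrix.of fun a b : Fin n => J (Pi.single b 1) a) *
        α (fun k => A (Pi.single k 1)) := by
  let b := Pi.basisFun ℂ (Fin n)
  have h3 : α (fun k => A (J (Pi.single k 1))) = α.compLinearMap A (J ∘ b) := by
    simp [b, Function.comp_def]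
  have h4 : α (fun k => A (Pi.single k 1)) = α.compLinearMap A b := by
    simp [b]
  have h5 : LinearMap.det J = Matrix.det (Matrix.of fun a b : Fin n => J (Pi.single b 1) a) := by
    rw [← LinearMap.det_toMatrix']
    congr 1
  rw [h3, h4, AlternatingMap.eq_smul_basis_det b (α.compLinearMap A)]
  simp only [AlternatingMap.smul_apply, Module.Basis.det_comp, Module.Basis.det_self, smul_eq_mul,
    mul_one, h5]
  exact mul_comm _ _

/-- Two parametrisations that differ by a change of variables `F` have coordinate frames that differ
by the Jacobian determinant of `F`. -/
theorem alternatingMap_mfderiv_comp {φ ψ : Cn n → X} {F : Cn n → Cn n} {w : Cn n}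
    (hψ : MDifferentiableAt 𝓘(ℂ, Cn n) 𝓘(ℂ, Cn n) ψ (F w)) (hF : DifferentiableAt ℂ F w)
    (h : φ =ᶠ[𝓝 w] ψ ∘ F) (α : Cn n [⋀^Fin n]→ₗ[ℂ] ℂ) :
    α (fun k => (mfderiv 𝓘(ℂ, Cn n) 𝓘(ℂ, Cn n) φ w : Cn n →L[ℂ] Cn n) (Pi.single k 1)) =
      Matrix.det (Matrix.of fun a b : Fin n => fderiv ℂ F w (Pi.single b 1) a) *
        α (fun k => (mfderiv 𝓘(ℂ, Cn n) 𝓘(ℂ, Cn n) ψ (F w) : Cn n →L[ℂ] Cn n)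
          (Pi.single k 1)) := by
  -- The form `α` lives on `ℂⁿ`, to which all tangent spaces unfold, so no transport between those
  -- at `φ w` and `ψ (F w)` is needed.
  have h1 := mfderiv_comp w hψ hF.mdifferentiableAt
  rw [← h.mfderiv_eq, mfderiv_eq_fderiv] at h1
  rw [h1]
  exact alternatingMap_comp_eq_det α
    (mfderiv 𝓘(ℂ, Cn n) 𝓘(ℂ, Cn n) ψ (F w) : Cn n →L[ℂ] Cn n).toLinearMap
    (fderiv ℂ F w).toLinearMap

variable {e e' : OpenPartialHomeomorph X (Cn n)}

theorem mdifferentiableAt_symm_of_mem_maximalAtlas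
    (he : e ∈ IsManifold.maximalAtlas 𝓘(ℂ, Cn n) ω X) {w : Cn n} (hw : w ∈ e.target) :
    MDifferentiableAt 𝓘(ℂ, Cn n) 𝓘(ℂ, Cn n) e.symm w :=
  (contMDiffAt_symm_of_mem_maximalAtlas he hw).mdifferentiableAt (by simp)

theorem contMDiffOn_jacobian_of_mem_maximalAtlas
    (he : e ∈ IsManifold.maximalAtlas 𝓘(ℂ, Cn n) ω X)
    (he' : e' ∈ IsManifold.maximalAtlas 𝓘(ℂ, Cn n) ω X) :
    ContMDiffOn 𝓘(ℂ, Cn n) 𝓘(ℂ, ℂ) ω (jacobian e e') (e.source ∩ e'.source) := by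
  have h2 : ContDiffOn ℂ ω (fun w => fderiv ℂ (fun w => e' (e.symm w)) w)
      (e.target ∩ e.symm ⁻¹' e'.source) :=
    (Blowup.contDiffOn_coordChange he he').fderiv_of_isOpen
      (e.isOpen_inter_preimage_symm e'.open_source) (by simp)
  have h3 : ContDiffOn ℂ ω (fun w => Matrix.det (Matrix.of fun a b : Fin n =>
      fderiv ℂ (fun w => e' (e.symm w)) w (Pi.single b 1) a))
      (e.target ∩ e.symm ⁻¹' e'.source) := by
    simp only [Matrix.det_apply, Matrix.of_apply]
    refine ContDiffOn.sum fun σ _ => ContDiffOn.const_smul _ ?_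
    refine contDiffOn_prod fun a _ => ?_
    exact contDiffOn_pi.1 (h2.clm_apply contDiffOn_const) _
  refine h3.contMDiffOn.comp ((contMDiffOn_of_mem_maximalAtlas he).mono Set.inter_subset_left) ?_
  intro x hx
  exact ⟨e.map_source hx.1, by simpa [e.left_inv hx.1] using hx.2⟩

/-- The version for charts of the maximal atlas is needed because the blowup coordinates `c.chart`
need not belong to the chosen atlas of `M`. -/
theorem alternatingMap_coordVector_of_mem_maximalAtlas
    (he : e ∈ IsManifold.maximalAtlas 𝓘(ℂ, Cn n) ω X)
    (he' : e' ∈ IsManifold.maximalAtlas 𝓘(ℂ, Cn n) ω X) {x : X} (hx : x ∈ e.source)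
    (hx' : x ∈ e'.source) (α : TangentSpace 𝓘(ℂ, Cn n) x [⋀^Fin n]→ₗ[ℂ] ℂ) :
    α (coordVector e x) = jacobian e e' x * α (coordVector e' x) := by
  have hmem : e.target ∩ e.symm ⁻¹' e'.source ∈ 𝓝 (e x) :=
    (e.isOpen_inter_preimage_symm e'.open_source).mem_nhds
      ⟨e.map_source hx, by simpa [e.left_inv hx] using hx'⟩
  have hF : DifferentiableAt ℂ (fun w => e' (e.symm w)) (e x) :=
    ((Blowup.contDiffOn_coordChange he he').contDiffAt hmem).differentiableAt (by simp)
  have hw : e' (e.symm (e x)) = e' x := by rw [e.left_inv hx]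
  have h := alternatingMap_mfderiv_comp (φ := e.symm) (ψ := e'.symm)
    (F := fun w => e' (e.symm w)) (w := e x)
    (by
      rw [hw]
      exact mdifferentiableAt_symm_of_mem_maximalAtlas he' (e'.map_source hx')) hF
    (by filter_upwards [hmem] with w hw using (e'.left_inv hw.2).symm) α
  refine h.trans (congrArg (fun t => jacobian e e' x * t) ?_)
  -- The two frames differ only in the point of `ℂⁿ` at which the derivative of `e'.symm` is taken.
  exact congrArg (fun y => α (fun k => (show Cn n →L[ℂ] Cn n from
    mfderiv 𝓘(ℂ, Cn n) 𝓘(ℂ, Cn n) e'.symm y) (Pi.single k 1))) hw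

/-- Changing frames from `e'` to `e` and back shows that the two Jacobians have product `1`, as is
seen on the determinant form of the basis `coordBasis`, which takes the value `1` on the frame of
`e'`. -/
theorem jacobian_ne_zero [IsManifold 𝓘(ℂ, Cn n) ω X]
    (he : e ∈ IsManifold.maximalAtlas 𝓘(ℂ, Cn n) ω X)
    (he' : e' ∈ atlas (Cn n) X) {x : X} (hx : x ∈ e.source) (hx' : x ∈ e'.source) :
    jacobian e e' x ≠ 0 := by
  have hm' := IsManifold.subset_maximalAtlas (I := 𝓘(ℂ, Cn n)) (n := ω) he'
  have h1 := alternatingMap_coordVector_of_mem_maximalAtlas hm' he hx' hx (coordBasis he' hx').det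
  rw [alternatingMap_coordVector_of_mem_maximalAtlas he hm' hx hx', ← coordBasis_apply he' hx',
    Module.Basis.det_self] at h1
  intro h0
  simp [h0] at h1

end jacobian

/-! ### The canonical bundle of the blowup -/

namespace Blowup

/-- The Jacobian determinant of the blowup map in affine coordinates is `wᵢⁿ⁻¹`. -/
theorem det_fderiv_down {n : ℕ} (i : Fin n) (w : Cn n) :
    Matrix.det (Matrix.of fun a b : Fin n => fderiv ℂ (down i) w (Pi.single b 1) a) =
      w i ^ ((n : ℤ) - 1) := by
  let d : Fin n → ℂ := fun j => if j = i then 1 else w i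
  have hd : HasFDerivAt (down i) (ContinuousLinearMap.pi fun j : Fin n =>
      if j = i then (ContinuousLinearMap.proj i : Cn n →L[ℂ] ℂ)
      else w i • (ContinuousLinearMap.proj j : Cn n →L[ℂ] ℂ) +
        w j • (ContinuousLinearMap.proj i : Cn n →L[ℂ] ℂ)) w := by
    refine hasFDerivAt_pi.2 fun j => ?_
    by_cases hj : j = i
    · simp only [down, hj, if_true]
      exact hasFDerivAt_apply i w
    · simp only [down, hj, if_false]
      exact (hasFDerivAt_apply i w).mul (hasFDerivAt_apply j w)
  have h1 : Matrix.det (Matrix.of fun a b : Fin n => fderiv ℂ (down i) w (Pi.single b 1) a) =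
      Matrix.det (Matrix.diagonal d) := by
    rw [hd.fderiv]
    -- Row `i` is the unit vector at `i`, and row `a ≠ i` is `w i` times the unit vector at `a` plus
    -- `w a` times row `i`. Subtracting these multiples of row `i` leaves the diagonal matrix.
    refine Matrix.det_eq_of_forall_row_eq_smul_add_const (fun j => if j = i then 0 else w j) i
      (by simp) fun a b => ?_
    by_cases ha : a = i
    · subst ha
      simp [Matrix.diagonal_apply, Pi.single_apply, d]
    · simp [Matrix.diagonal_apply, Pi.single_apply, d, ha]
  rw [h1, Matrix.det_diagonal, ← Finset.mul_prod_erase _ _ (Finset.mem_univ i),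
    Finset.prod_congr rfl (g := fun _ => w i) fun j hj => if_neg (Finset.ne_of_mem_erase hj)]
  -- The existence of `i` forces `n ≥ 1`, so the integer exponent `n - 1` agrees with the natural
  -- number of remaining factors.
  have hn : 1 ≤ n := Nat.one_le_iff_ne_zero.2 fun h => (h ▸ i).elim0
  simp only [d, if_true, one_mul, Finset.prod_const, Finset.card_erase_of_mem (Finset.mem_univ i),
    Finset.card_univ, Fintype.card_fin]
  rw [← zpow_natCast, Nat.cast_sub hn, Nat.cast_one]

variable {n : ℕ} {M : Type u} [TopologicalSpace M] [ChartedSpace (Cn n) M]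
  {x : M} (c : LocalCoord n x)

/-! ### A cover adapted to both line bundles -/

/-- The charts of the blowup which trivialise both sides of the canonical bundle formula. -/
def chartOf : {p : M // p ≠ x} ⊕ Fin n → PartialEquiv (Blowup c) (Cn n) :=
  Sum.elim (awayChart c) (affineChart c)

theorem chartOf_mem_charts (k : {p : M // p ≠ x} ⊕ Fin n) : chartOf c k ∈ charts c := by
  rcases k with p | i
  · exact Or.inl ⟨p, rfl⟩
  · exact Or.inr ⟨i, rfl⟩

/-- The point of `M` whose preferred chart is paired with the chart `chartOf c k`. -/
def basePoint : {p : M // p ≠ x} ⊕ Fin n → M :=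
  Sum.elim Subtype.val fun _ => x

/-- The local defining function of `E` paired with the chart `chartOf c k`. -/
def divisorIndex : {p : M // p ≠ x} ⊕ Fin n → Option (Fin n) :=
  Sum.elim (fun _ => none) some

/-- The local expression of the isomorphism between the two sides of the canonical bundle
formula. -/
def isoFun : {p : M // p ≠ x} ⊕ Fin n → Blowup c → ℂ
  | .inl _, _ => 1
  | .inr _, q => jacobian c.chart (chartAt (Cn n) x) (proj c q)

/-- The domain on which the charts paired with the index `k` are defined. -/
def isoSet (k : {p : M // p ≠ x} ⊕ Fin n) : Set (Blowup c) :=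
  (chartOf c k).source ∩ proj c ⁻¹' (chartAt (Cn n) (basePoint k)).source

theorem isoSet_subset_excBaseSet (k : {p : M // p ≠ x} ⊕ Fin n) :
    isoSet c k ⊆ excBaseSet c (divisorIndex k) := by
  rcases k with p | i
  · exact fun q hq => hq.1.1
  · exact fun q hq => hq.1

theorem exists_mem_isoSet (q : Blowup c) : ∃ k, q ∈ isoSet c k := by
  rcases q with ⟨p, hp⟩ | l
  · exact ⟨.inl ⟨p, hp⟩, ⟨hp, mem_chart_source (Cn n) p⟩, mem_chart_source (Cn n) p⟩
  · obtain ⟨i, hi⟩ := Function.ne_iff.1 l.rep_nonzero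
    exact ⟨.inr i, ⟨c.mem_source, hi⟩, mem_chart_source (Cn n) x⟩

variable [IsManifold 𝓘(ℂ, Cn n) ω M]

/-! ### Pullback of `n`-forms in local coordinates -/

/-- The charts of the blowup as open partial homeomorphisms. -/
def openChart {e : PartialEquiv (Blowup c) (Cn n)} (he : e ∈ charts c) :
    OpenPartialHomeomorph (Blowup c) (Cn n) :=
  (core c).openPartialHomeomorph e he

theorem openChart_mem_atlas {e : PartialEquiv (Blowup c) (Cn n)} (he : e ∈ charts c) :
    openChart c he ∈ atlas (Cn n) (Blowup c) :=
  Set.mem_iUnion₂.2 ⟨e, he, rfl⟩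

/-- The value of the pullback `π^*β` of an `n`-form on the coordinate frame of a chart. -/
theorem pullback_coordVector {e : PartialEquiv (Blowup c) (Cn n)} (he : e ∈ charts c)
    {q : Blowup c} (hq : q ∈ e.source) {F : Cn n → Cn n} {ψ : Cn n → M}
    (hψ : MDifferentiableAt 𝓘(ℂ, Cn n) 𝓘(ℂ, Cn n) ψ (F (e q)))
    (hF : DifferentiableAt ℂ F (e q))
    (h : ∀ w ∈ e.target, proj c (e.symm w) = ψ (F w))
    (β : TangentSpace 𝓘(ℂ, Cn n) (proj c q) [⋀^Fin n]→ₗ[ℂ] ℂ) :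
    β.compLinearMap (mfderiv 𝓘(ℂ, Cn n) 𝓘(ℂ, Cn n) (proj c) q).toLinearMap
        (coordVector (openChart c he) q) =
      Matrix.det (Matrix.of fun a b : Fin n => fderiv ℂ F (e q) (Pi.single b 1) a) *
        (β : Cn n [⋀^Fin n]→ₗ[ℂ] ℂ) (fun k =>
          (mfderiv 𝓘(ℂ, Cn n) 𝓘(ℂ, Cn n) ψ (F (e q)) : Cn n →L[ℂ] Cn n) (Pi.single k 1)) := by
  let E := openChart c he
  have hE : E ∈ atlas (Cn n) (Blowup c) := openChart_mem_atlas c he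
  have hqE : q ∈ E.source := hq
  have hE1 : MDifferentiableAt 𝓘(ℂ, Cn n) 𝓘(ℂ, Cn n) E.symm (E q) :=
    mdifferentiableAt_atlas_symm hE (E.map_source hqE)
  have hp : MDifferentiableAt 𝓘(ℂ, Cn n) 𝓘(ℂ, Cn n) (proj c) (E.symm (E q)) :=
    (contMDiff_proj c).mdifferentiable (by simp) _
  have hev : proj c ∘ E.symm =ᶠ[𝓝 (E q)] ψ ∘ F := by
    filter_upwards [E.open_target.mem_nhds (E.map_source hqE)] with w hw using h w hw
  have h2 := alternatingMap_mfderiv_comp (w := E q) hψ hF hev β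
  have h1 := mfderiv_comp (E q) hp hE1
  rw [h1] at h2
  refine Eq.trans ?_ h2
  -- The chain rule differentiates `proj c` at `E.symm (E q)`, which is identified here with `q`.
  exact congrArg (fun y => (β : Cn n [⋀^Fin n]→ₗ[ℂ] ℂ) (fun k => (show Cn n →L[ℂ] Cn n from
    mfderiv 𝓘(ℂ, Cn n) 𝓘(ℂ, Cn n) (proj c) y) (coordVector E q k))) (E.left_inv hqE).symm

theorem contMDiffOn_isoFun (k : {p : M // p ≠ x} ⊕ Fin n) :
    ContMDiffOn 𝓘(ℂ, Cn n) 𝓘(ℂ, ℂ) ω (isoFun c k) (isoSet c k) := by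
  rcases k with p | i
  · exact contMDiffOn_const
  · exact (contMDiffOn_jacobian_of_mem_maximalAtlas c.mem_maximalAtlas
      (IsManifold.chart_mem_maximalAtlas x)).comp (contMDiff_proj c).contMDiffOn
        fun q hq => ⟨hq.1.1, hq.2⟩

theorem isoFun_ne_zero (k : {p : M // p ≠ x} ⊕ Fin n) (q : Blowup c) (hq : q ∈ isoSet c k) :
    isoFun c k q ≠ 0 := by
  rcases k with p | i
  · exact one_ne_zero
  · exact jacobian_ne_zero c.mem_maximalAtlas (chart_mem_atlas (Cn n) x) hq.1.1 hq.2

/-- In local coordinates, `π^*β` is `β` multiplied by the power `n - 1` of the defining function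
of `E`, up to the nonvanishing function `isoFun`. -/
theorem pullback_coordVector_chartOf (k : {p : M // p ≠ x} ⊕ Fin n) {q : Blowup c}
    (hq : q ∈ isoSet c k) (β : TangentSpace 𝓘(ℂ, Cn n) (proj c q) [⋀^Fin n]→ₗ[ℂ] ℂ) :
    β.compLinearMap (mfderiv 𝓘(ℂ, Cn n) 𝓘(ℂ, Cn n) (proj c) q).toLinearMap
        (coordVector (openChart c (chartOf_mem_charts c k)) q) =
      isoFun c k q * (excFun c (divisorIndex k) q ^ ((n : ℤ) - 1) *
        β (coordVector (chartAt (Cn n) (basePoint k)) (proj c q))) := by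
  rcases k with p | i
  · have hm := IsManifold.chart_mem_maximalAtlas (I := 𝓘(ℂ, Cn n)) (n := ω) p.1
    -- Away from the centre the chart of the blowup is the lift of a chart of `M`, so `π` is the
    -- identity in coordinates.
    refine (pullback_coordVector c (chartOf_mem_charts c (.inl p)) hq.1 (F := fun w => w)
      (ψ := (chartAt (Cn n) p.1).symm)
      (mdifferentiableAt_symm_of_mem_maximalAtlas hm ((chartAt (Cn n) p.1).map_source hq.2))
      differentiableAt_id (fun w hw => proj_awayInv hw.2) β).trans ?_
    have hdet : Matrix.det (Matrix.of fun a b : Fin n =>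
        fderiv ℂ (fun w : Cn n => w) (chartOf c (.inl p) q) (Pi.single b 1) a) = 1 := by
      rw [fderiv_fun_id, ← Matrix.det_one (n := Fin n)]
      congr 1
      ext a b
      simp [Matrix.one_apply, Pi.single_apply]
    rw [hdet]
    simp only [isoFun, excFun, divisorIndex, Sum.elim_inl, one_zpow, one_mul]
    rfl
  · have hw : down i (affineFun c i q) = c.chart (proj c q) := down_affineFun hq.1.1 hq.1.2
    refine (pullback_coordVector c (chartOf_mem_charts c (.inr i)) hq.1 (F := down i)
      (ψ := c.chart.symm) ?_ ((contDiff_down i).contDiffAt.differentiableAt (by simp))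
      (fun w hw => proj_affineInv hw) β).trans ?_
    -- The target of the affine chart is by definition the preimage of `c.chart.target` under `down
    -- i`.
    · exact mdifferentiableAt_symm_of_mem_maximalAtlas c.mem_maximalAtlas
        ((affineChart c i).map_source hq.1)
    -- Passing from the frame of `z` to that of the atlas chart at `x` produces the factor `isoFun`.
    have h1 := alternatingMap_coordVector_of_mem_maximalAtlas c.mem_maximalAtlas
      (IsManifold.chart_mem_maximalAtlas x) hq.1.1 hq.2 β
    have h2 : (β : Cn n [⋀^Fin n]→ₗ[ℂ] ℂ) (fun k => (mfderiv 𝓘(ℂ, Cn n) 𝓘(ℂ, Cn n) c.chart.symm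
        (down i (affineFun c i q)) : Cn n →L[ℂ] Cn n) (Pi.single k 1)) =
        β (coordVector c.chart (proj c q)) :=
      congrArg (fun y => (β : Cn n [⋀^Fin n]→ₗ[ℂ] ℂ) (fun k => (show Cn n →L[ℂ] Cn n from
        mfderiv 𝓘(ℂ, Cn n) 𝓘(ℂ, Cn n) c.chart.symm y) (Pi.single k 1))) hw
    have h3 : excFun c (some i) q = chartOf c (.inr i) q i := excFun_some_eq c i q
    rw [det_fderiv_down, ← h3]
    refine (congrArg (fun t => excFun c (some i) q ^ ((n : ℤ) - 1) * t) (h2.trans h1)).trans ?_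
    exact mul_left_comm _ _ _

end Blowup

end

end KodairaBlowup

/-! ### The canonical bundle formula -/

theorem mainTheorem3 {n : ℕ} {M : Type*} [TopologicalSpace M] [ChartedSpace (Cn n) M]
    [IsManifold 𝓘(ℂ, Cn n) ω M] {x : M} (c : LocalCoord n x) :
    Nonempty (HolLineBundle.Iso (canonicalBundle n (Blowup c))
      (((canonicalBundle n M).pullback (Blowup.proj c) (Blowup.contMDiff_proj c)).tensor
        ((Blowup.exceptionalDivisor c).lineBundle ((n : ℤ) - 1)))) := by
  let D := Blowup.exceptionalDivisor c
  let e : M → {e : OpenPartialHomeomorph M (Cn n) // e ∈ atlas (Cn n) M} := fun p =>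
    ⟨chartAt (Cn n) p, chart_mem_atlas (Cn n) p⟩
  refine HolLineBundle.nonempty_iso_of_dense (Blowup.isoSet c)
    (fun k => ⟨Blowup.openChart c (Blowup.chartOf_mem_charts c k),
      Blowup.openChart_mem_atlas c _⟩)
    (fun k => (e (Blowup.basePoint k), Blowup.divisorIndex k)) (Blowup.isoFun c)
    (fun k => (Blowup.isOpen_source c (Blowup.chartOf_mem_charts c k)).inter
      ((chartAt (Cn n) (Blowup.basePoint k)).open_source.preimage
        (Blowup.contMDiff_proj c).continuous))
    (Blowup.exists_mem_isoSet c) (fun k q hq => hq.1)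
    (fun k q hq => ⟨hq.2, Blowup.isoSet_subset_excBaseSet c k hq⟩)
    (Blowup.contMDiffOn_isoFun c) (Blowup.isoFun_ne_zero c) D.dense_compl ?_
  intro q hq
  have hq0 : q ∈ D.baseSet none := hq
  have hp : Blowup.proj c q ∈ (chartAt (Cn n) (Blowup.proj c q)).source := mem_chart_source _ _
  let β := (coordBasis (chart_mem_atlas (Cn n) (Blowup.proj c q)) hp).det
  -- Fibres of `[(n-1)E]` are identified with `ℂ` through `indexAt`; this `s` is normalised to have
  -- coordinate `1` in the trivialisation `none`, whose local equation is `1`.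
  let s : ℂ := (D.ratio none (D.indexAt q) q ^ ((n : ℤ) - 1))⁻¹
  have hs : D.ratio none (D.indexAt q) q ^ ((n : ℤ) - 1) * s = 1 :=
    mul_inv_cancel₀ (zpow_ne_zero _ (D.ratio_ne_zero _ _ hq0 (D.mem_indexAt q)))
  refine ⟨β.compLinearMap (mfderiv 𝓘(ℂ, Cn n) 𝓘(ℂ, Cn n) (Blowup.proj c) q).toLinearMap,
    TensorProduct.tmul ℂ β s, ?_, ?_⟩
  · intro h
    have h1 := congrArg ((((canonicalBundle n M).pullback (Blowup.proj c)
      (Blowup.contMDiff_proj c)).tensor (D.lineBundle ((n : ℤ) - 1))).triv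
        (e (Blowup.proj c q), none) q) h
    rw [map_zero] at h1
    -- In the trivialisation `none`, together with the chart of `M` at the image point, the
    -- coordinate of `β ⊗ s` is `1 * 1`, so this vector is nonzero.
    have h2 : β (coordVector (chartAt (Cn n) (Blowup.proj c q)) (Blowup.proj c q)) *
        (D.ratio none (D.indexAt q) q ^ ((n : ℤ) - 1) * s) = 0 := h1
    rw [hs, mul_one, ← coordBasis_apply (chart_mem_atlas (Cn n) (Blowup.proj c q)) hp,
      Module.Basis.det_self] at h2
    exact one_ne_zero h2
  · intro k hk
    refine (Blowup.pullback_coordVector_chartOf c k hk β).trans ?_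
    congr 1
    have hkD : q ∈ D.baseSet (Blowup.divisorIndex k) := Blowup.isoSet_subset_excBaseSet c k hk
    have h1 : D.f (Blowup.divisorIndex k) q = D.ratio (Blowup.divisorIndex k) none q := by
      rw [D.f_eq_ratio_mul _ none q ⟨hkD, hq0⟩]
      exact mul_one _
    -- By the cocycle identity through `none`, the coordinate of `s` in any of these trivialisations
    -- is the power `n - 1` of the local equation, which is exactly the Jacobian factor in the
    -- pullback of `β`.
    have h2 : D.ratio (Blowup.divisorIndex k) (D.indexAt q) q ^ ((n : ℤ) - 1) * s =
        D.f (Blowup.divisorIndex k) q ^ ((n : ℤ) - 1) := by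
      rw [← D.ratio_mul_ratio _ none _ hkD hq0 (D.mem_indexAt q), mul_zpow, mul_assoc, hs, mul_one,
        h1]
    change D.f (Blowup.divisorIndex k) q ^ ((n : ℤ) - 1) * _ = _ *
      (D.ratio (Blowup.divisorIndex k) (D.indexAt q) q ^ ((n : ℤ) - 1) * s)
    rw [h2]
    exact mul_comm _ _
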